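/- Let $R$ be a commutative ring with unity and let $C$ be a semidualizing $R$-module, i.e. $C$ has a resolution by finitely generated projective $R$-modules, the homothety map $R\to\operatorname{Hom}_R(C,C)$ is an isomorphism, and $\operatorname{Ext}^i_R(C,C)=0$ for all $i\ge 1$. Let $\mathcal P_C$ be the class of modules isomorphic to $C\otimes_R P$ with $P$ projective, and $\mathcal I_C$ the class of modules isomorphic to $\operatorname{Hom}_R(C,I)$ with $I$ injective. A module $M$ is $G_C$-projective if $M\cong\operatorname{Coker}(P_1\to P_0)$ for some exact sequence $$\cdots\to P_1\to P_0\to C\otimes_R P^0\to C\otimes_R P^1\to\cdots$$ with all $P_i,P^i$ projective that stays exact under $\operatorname{Hom}_R(-,T)$ for every $T\in\mathcal P_C$. Dually, $M$ is $G_C$-injective if $M\cong\operatorname{Ker}(I^0\to I^1)$ for some exact sequence $$\cdots\to \operatorname{Hom}_R(C,I_1)\to\operatorname{Hom}_R(C,I_0)\to I^0\to I^1\to\cdots$$ with all $I_i,I^i$ injective that stays exact under $\operatorname{Hom}_R(T,-)$ for every $T\in\mathcal I_C$. For a class $\mathcal X$ of modules, $\mathcal X\text{-}\mathrm{pd}_R(M)$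 is the infimum of $\sup\{n\ge 0: X_n\ne 0\}$ over all exact sequences $\cdots\to X_1\to X_0\to M\to 0$ with all $X_n\in\mathcal X$ (it is $\infty$ if there are none), and $\mathcal X\text{-}\mathrm{id}_R(M)$ is defined dually by exact sequences $0\to M\to X^0\to X^1\to\cdots$. Write $G_C\text{-}\mathrm{pd}$ for $\mathcal X\text{-}\mathrm{pd}$ with $\mathcal X$ the class of $G_C$-projective modules, and $G_C\text{-}\mathrm{id}$ for $\mathcal X\text{-}\mathrm{id}$ with $\mathcal X$ the class of $G_C$-injective modules. The $C$-Gorenstein global dimension of $R$ is the common value of $\sup_N G_C\text{-}\mathrm{pd}_R(N)$ and $\sup_N G_C\text{-}\mathrm{id}_R(N)$, the suprema being over all $R$-modules $N$. **Proposition 4.7.** Suppose that the $C$-Gorenstein global dimension of $R$ is finite; it is enough to suppose that one of $\sup_N G_C\text{-}\mathrm{pd}_R(N)$ and $\sup_N G_C\text{-}\mathrm{id}_R(N)$ is finite. Then for every $R$-module $M$: 1. $\mathcal P_C\text{-}\mathrm{pd}_R(M)<\infty$ if and only if $\mathrm{id}_R(M)<\infty$; 2. $\mathcal I_C\text{-}\mathrm{id}_R(M)<\infty$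 if and only if $\mathrm{pd}_R(M)<\infty$, where $\mathrm{id}_R$ and $\mathrm{pd}_R$ are the classical injective and projective dimensions. -/

import Mathlib

open CategoryTheory TensorProduct

universe u

namespace RelHom

variable {R : Type u} [CommRing R]

/-- A module `C` over a commutative ring is semidualizing if it has a resolution by finitely
generated projective modules, the homothety map `R → Hom_R(C, C)` is bijective, and
`Ext^i_R(C, C) = 0` for all `i ≥ 1`. -/
structure IsSemidualizing (C : ModuleCat.{u} R) : Prop where
  exists_resolution : ∃ P : ProjectiveResolution C, ∀ n, Module.Finite R (P.complex.X n)
  homothety_bijective : Function.Bijective (LinearMap.lsmul R C)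
  ext_subsingleton : ∀ i : ℕ, 1 ≤ i → Subsingleton (Abelian.Ext C C i)

/-- The class `P_C` of `C`-projective modules: those isomorphic to `C ⊗ P`, `P` projective. -/
def IsCProjective (C : ModuleCat.{u} R) : ObjectProperty (ModuleCat.{u} R) := fun X =>
  ∃ P : ModuleCat.{u} R, Module.Projective R P ∧ Nonempty (X ≃ₗ[R] C ⊗[R] P)

/-- The class `I_C` of `C`-injective modules: those isomorphic to `Hom(C, I)`, `I` injective. -/
def IsCInjective (C : ModuleCat.{u} R) : ObjectProperty (ModuleCat.{u} R) := fun X =>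
  ∃ I : ModuleCat.{u} R, Module.Injective R I ∧ Nonempty (X ≃ₗ[R] (C →ₗ[R] I))

/-- A sequence of modules and linear maps, infinite in both directions,
`⋯ → A 1 → A 0 → B 0 → B 1 → ⋯`. -/
structure BiSequence (R : Type u) [CommRing R] where
  /-- the left half -/
  A : ℕ → ModuleCat.{u} R
  /-- the right half -/
  B : ℕ → ModuleCat.{u} R
  /-- the maps of the left half -/
  dA : ∀ n, A (n + 1) →ₗ[R] A n
  /-- the map in the middle -/
  mid : A 0 →ₗ[R] B 0
  /-- the maps of the right half -/
  dB : ∀ n, B n →ₗ[R] B (n + 1)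

namespace BiSequence

variable (S : BiSequence R)

/-- The sequence is exact at every place. -/
structure IsExact : Prop where
  exact_A : ∀ n, Function.Exact (S.dA (n + 1)) (S.dA n)
  exact_A_zero : Function.Exact (S.dA 0) S.mid
  exact_B_zero : Function.Exact S.mid (S.dB 0)
  exact_B : ∀ n, Function.Exact (S.dB n) (S.dB (n + 1))

/-- The sequence `⋯ → Hom(B 1, T) → Hom(B 0, T) → Hom(A 0, T) → Hom(A 1, T) → ⋯`
is exact at every place. -/
structure IsExactHomTo (T : ModuleCat.{u} R) : Prop where
  exact_A : ∀ n, Function.Exact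
    (fun f : S.A n →ₗ[R] T => f ∘ₗ S.dA n)
    (fun f : S.A (n + 1) →ₗ[R] T => f ∘ₗ S.dA (n + 1))
  exact_A_zero : Function.Exact
    (fun f : S.B 0 →ₗ[R] T => f ∘ₗ S.mid)
    (fun f : S.A 0 →ₗ[R] T => f ∘ₗ S.dA 0)
  exact_B_zero : Function.Exact
    (fun f : S.B 1 →ₗ[R] T => f ∘ₗ S.dB 0)
    (fun f : S.B 0 →ₗ[R] T => f ∘ₗ S.mid)
  exact_B : ∀ n, Function.Exact
    (fun f : S.B (n + 2) →ₗ[R] T => f ∘ₗ S.dB (n + 1))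
    (fun f : S.B (n + 1) →ₗ[R] T => f ∘ₗ S.dB n)

/-- The sequence `⋯ → Hom(T, A 1) → Hom(T, A 0) → Hom(T, B 0) → Hom(T, B 1) → ⋯`
is exact at every place. -/
structure IsExactHomFrom (T : ModuleCat.{u} R) : Prop where
  exact_A : ∀ n, Function.Exact
    (fun f : T →ₗ[R] S.A (n + 2) => S.dA (n + 1) ∘ₗ f)
    (fun f : T →ₗ[R] S.A (n + 1) => S.dA n ∘ₗ f)
  exact_A_zero : Function.Exact
    (fun f : T →ₗ[R] S.A 1 => S.dA 0 ∘ₗ f)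
    (fun f : T →ₗ[R] S.A 0 => S.mid ∘ₗ f)
  exact_B_zero : Function.Exact
    (fun f : T →ₗ[R] S.A 0 => S.mid ∘ₗ f)
    (fun f : T →ₗ[R] S.B 0 => S.dB 0 ∘ₗ f)
  exact_B : ∀ n, Function.Exact
    (fun f : T →ₗ[R] S.B n => S.dB n ∘ₗ f)
    (fun f : T →ₗ[R] S.B (n + 1) => S.dB (n + 1) ∘ₗ f)

/-- A complete `PP_C`-resolution: an exact and `Hom(-, P_C)`-exact sequence
`⋯ → P_1 → P_0 → C ⊗ P^0 → C ⊗ P^1 → ⋯` with all `P_i` and `P^i` projective. -/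
structure IsCompletePPC (C : ModuleCat.{u} R) : Prop where
  projective_A : ∀ n, Module.Projective R (S.A n)
  cProjective_B : ∀ n, IsCProjective C (S.B n)
  exact : S.IsExact
  exact_hom : ∀ T, IsCProjective C T → S.IsExactHomTo T

/-- A complete `I_C I`-resolution: an exact and `Hom(I_C, -)`-exact sequence
`⋯ → Hom(C, I_1) → Hom(C, I_0) → I^0 → I^1 → ⋯` with all `I_i` and `I^i` injective. -/
structure IsCompleteICI (C : ModuleCat.{u} R) : Prop where
  cInjective_A : ∀ n, IsCInjective C (S.A n)
  injective_B : ∀ n, Module.Injective R (S.B n)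
  exact : S.IsExact
  exact_hom : ∀ T, IsCInjective C T → S.IsExactHomFrom T

end BiSequence

/-- `M` is `G_C`-projective: `M ≅ Coker (P_1 → P_0)` for a complete `PP_C`-resolution. -/
def IsGCProjective (C : ModuleCat.{u} R) : ObjectProperty (ModuleCat.{u} R) := fun M =>
  ∃ S : BiSequence R, S.IsCompletePPC C ∧
    Nonempty (M ≃ₗ[R] (S.A 0 ⧸ LinearMap.range (S.dA 0)))

/-- `M` is `G_C`-injective: `M ≅ Ker (I^0 → I^1)` for a complete `I_C I`-resolution. -/
def IsGCInjective (C : ModuleCat.{u} R) : ObjectProperty (ModuleCat.{u} R) := fun M =>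
  ∃ S : BiSequence R, S.IsCompleteICI C ∧
    Nonempty (M ≃ₗ[R] LinearMap.ker (S.dB 0))

/-- An `𝒳`-resolution of `M`: an exact sequence `⋯ → X 1 → X 0 → M → 0` with all `X n` in the
class `𝒳`. -/
structure Resolution (𝒳 : ObjectProperty (ModuleCat.{u} R)) (M : ModuleCat.{u} R) where
  /-- the terms -/
  X : ℕ → ModuleCat.{u} R
  mem : ∀ n, 𝒳 (X n)
  /-- the maps -/
  d : ∀ n, X (n + 1) →ₗ[R] X n
  /-- the augmentation -/
  ε : X 0 →ₗ[R] M
  exact : ∀ n, Function.Exact (d (n + 1)) (d n)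
  exact_zero : Function.Exact (d 0) ε
  surjective : Function.Surjective ε

/-- An `𝒳`-coresolution of `M`: an exact sequence `0 → M → X 0 → X 1 → ⋯` with all `X n` in the
class `𝒳`. -/
structure Coresolution (𝒳 : ObjectProperty (ModuleCat.{u} R)) (M : ModuleCat.{u} R) where
  /-- the terms -/
  X : ℕ → ModuleCat.{u} R
  mem : ∀ n, 𝒳 (X n)
  /-- the maps -/
  d : ∀ n, X n →ₗ[R] X (n + 1)
  /-- the augmentation -/
  ε : M →ₗ[R] X 0
  exact : ∀ n, Function.Exact (d n) (d (n + 1))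
  exact_zero : Function.Exact ε (d 0)
  injective : Function.Injective ε

/-- The length `sup {n | X n ≠ 0}` of a sequence of modules (`⊥` if all of them vanish, `⊤` if
infinitely many do not). -/
noncomputable def seqLength (X : ℕ → ModuleCat.{u} R) : WithBot ℕ∞ :=
  ⨆ (n : ℕ) (_ : Nontrivial (X n)), ((n : ℕ∞) : WithBot ℕ∞)

/-- The `𝒳`-projective dimension of `M`: the infimum of the lengths of its `𝒳`-resolutions
(`⊤` if there is none). -/
noncomputable def relProjDim (𝒳 : ObjectProperty (ModuleCat.{u} R)) (M : ModuleCat.{u} R) :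
    WithBot ℕ∞ :=
  ⨅ r : Resolution 𝒳 M, seqLength r.X

/-- The `𝒳`-injective dimension of `M`: the infimum of the lengths of its `𝒳`-coresolutions
(`⊤` if there is none). -/
noncomputable def relInjDim (𝒳 : ObjectProperty (ModuleCat.{u} R)) (M : ModuleCat.{u} R) :
    WithBot ℕ∞ :=
  ⨅ r : Coresolution 𝒳 M, seqLength r.X

/-- The `G_C`-projective dimension of the ring: the supremum of the `G_C`-projective dimensions
of all modules. -/
noncomputable def gcProjGlobalDim (C : ModuleCat.{u} R) : WithBot ℕ∞ :=
  ⨆ M : ModuleCat.{u} R, relProjDim (IsGCProjective C) M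

/-- The `G_C`-injective dimension of the ring: the supremum of the `G_C`-injective dimensions
of all modules. -/
noncomputable def gcInjGlobalDim (C : ModuleCat.{u} R) : WithBot ℕ∞ :=
  ⨆ M : ModuleCat.{u} R, relInjDim (IsGCInjective C) M

end RelHom

/-! Everything reduces to two facts: (P) `C ⊗ P` has finite injective dimension for every projective
`P`, and (I) `Hom(C, I)` has finite projective dimension for every injective `I`; see
`relDim_lt_top_iff`. By (P), finite injective dimension passes along a finite `P_C`-resolution.
Conversely, if `M` has finite injective dimension, then `C ⊗ Hom(C, M) ≅ M`, the positive Tor of `C`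
and `Hom(C, M)` vanishes, and by (I) `Hom(C, M)` has finite projective dimension
(`InjDimFinite.bass`); tensoring a finite projective resolution of it with `C` gives a finite
`P_C`-resolution of `M`. The second equivalence is dual, through `M ≅ Hom(C, C ⊗ M)`
(`ProjDimFinite.auslander`).

Suppose the `G_C`-projective dimensions are bounded by a common number. Since `Ext^i(G, T) = 0` for
`i ≥ 1`, `G` `G_C`-projective and `T` in `P_C`, dimension shifting kills `Ext^i(-, T)` on all
modules for large `i`, which is (P). For (I), an Auslander–Buchweitz approximation `0 → I → X → G →
0` with `X` of finite `P_C`-dimension (`FinRes.exists_approximation`) splits because `I` is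
injective; so `Hom(C, I)` is a summand of `Hom(C, X)`, and `Hom(C, -)` turns a finite
`P_C`-resolution of `X` into a projective one. A bound on `G_C`-injective dimensions gives (I) and
(P) by the dual arguments, so the equality of the two global dimensions is not needed.

The semidualizing hypothesis enters as the exactness of `0 → R → Hom(P₀, C) → Hom(P₁, C) → ⋯` for a
resolution of `C` by finitely generated projectives, and through faithfulness: `Hom(C, N) = 0`
forces `N = 0`. -/

namespace RelHom

/-! ### Vanishing of Ext along short exact sequences -/

section Ext

variable {R : Type u} [CommRing R]
variable {A B D X Y : Type u} [AddCommGroup A] [Module R A] [AddCommGroup B] [Module R B]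
  [AddCommGroup D] [Module R D] [AddCommGroup X] [Module R X] [AddCommGroup Y] [Module R Y]

/-- `0 → A → B → D → 0` is a short exact sequence of modules. -/
structure IsSES (f : A →ₗ[R] B) (g : B →ₗ[R] D) : Prop where
  inj : Function.Injective f
  exact : Function.Exact f g
  surj : Function.Surjective g

variable (R) in
/-- The group `Ext^n_R(X, Y)` vanishes. -/
def ExtZero (X Y : Type u) [AddCommGroup X] [Module R X] [AddCommGroup Y] [Module R Y]
    (n : ℕ) : Prop :=
  Subsingleton (Abelian.Ext (ModuleCat.of R X) (ModuleCat.of R Y) n)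

theorem extZero_iff {n : ℕ} :
    ExtZero R X Y n ↔ ∀ x : Abelian.Ext (ModuleCat.of R X) (ModuleCat.of R Y) n, x = 0 :=
  subsingleton_iff_forall_eq 0

theorem ext_comp_eq_zero_of_right {X Y Z : ModuleCat.{u} R} {a b c : ℕ}
    (x : Abelian.Ext X Y a) {y : Abelian.Ext Y Z b} (hy : y = 0) (h : a + b = c) :
    x.comp y h = 0 := by
  rw [hy, Abelian.Ext.comp_zero]

theorem ext_comp_eq_zero_of_left {X Y Z : ModuleCat.{u} R} {a b c : ℕ}
    {x : Abelian.Ext X Y a} (hx : x = 0) (y : Abelian.Ext Y Z b) (h : a + b = c) :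
    x.comp y h = 0 := by
  rw [hx, Abelian.Ext.zero_comp]

theorem ExtZero.of_projective [Module.Projective R X] (n : ℕ) : ExtZero R X Y (n + 1) :=
  extZero_iff.2 fun x => x.eq_zero_of_projective

theorem ExtZero.of_injective [Module.Injective R Y] (n : ℕ) : ExtZero R X Y (n + 1) :=
  have := Module.injective_object_of_injective_module R Y
  extZero_iff.2 fun x => x.eq_zero_of_injective

theorem ExtZero.congr_right {Y' : Type u} [AddCommGroup Y'] [Module R Y'] {n : ℕ}
    (h : ExtZero R X Y n) (e : Y ≃ₗ[R] Y') : ExtZero R X Y' n := by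
  rw [extZero_iff] at h ⊢
  intro x
  have h1 := h (x.comp (Abelian.Ext.mk₀ e.toModuleIso.inv) (add_zero n))
  have h2 : (x.comp (Abelian.Ext.mk₀ e.toModuleIso.inv) (add_zero n)).comp
      (Abelian.Ext.mk₀ e.toModuleIso.hom) (add_zero n) = x := by
    rw [Abelian.Ext.comp_assoc_of_second_deg_zero, Abelian.Ext.mk₀_comp_mk₀, Iso.inv_hom_id,
      Abelian.Ext.comp_mk₀_id]
  rw [← h2, h1, Abelian.Ext.zero_comp]

theorem ExtZero.congr_left {X' : Type u} [AddCommGroup X'] [Module R X'] {n : ℕ}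
    (h : ExtZero R X Y n) (e : X ≃ₗ[R] X') : ExtZero R X' Y n := by
  rw [extZero_iff] at h ⊢
  intro x
  have h1 := h ((Abelian.Ext.mk₀ e.toModuleIso.hom).comp x (zero_add n))
  have h2 : (Abelian.Ext.mk₀ e.toModuleIso.inv).comp
      ((Abelian.Ext.mk₀ e.toModuleIso.hom).comp x (zero_add n)) (zero_add n) = x := by
    rw [Abelian.Ext.mk₀_comp_mk₀_assoc, Iso.inv_hom_id, Abelian.Ext.mk₀_id_comp]
  rw [← h2, h1, Abelian.Ext.comp_zero]

namespace IsSES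

variable {f : A →ₗ[R] B} {g : B →ₗ[R] D} (h : IsSES f g)
include h

theorem shortExact :
    (ModuleCat.shortComplexOfCompEqZero f g h.exact.linearMap_comp_eq_zero).ShortExact :=
  ModuleCat.shortComplex_shortExact _ h.exact h.inj h.surj

theorem ext_mid {n : ℕ} (hA : ExtZero R X A n) (hD : ExtZero R X D n) : ExtZero R X B n := by
  rw [extZero_iff] at *
  intro x
  obtain ⟨y, rfl⟩ := Abelian.Ext.covariant_sequence_exact₂ _ h.shortExact x (hD _)
  rw [hA y, Abelian.Ext.zero_comp]

theorem ext_right {n : ℕ} (hB : ExtZero R X B n) (hA : ExtZero R X A (n + 1)) :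
    ExtZero R X D n := by
  rw [extZero_iff] at *
  intro x
  obtain ⟨y, rfl⟩ := Abelian.Ext.covariant_sequence_exact₃ _ h.shortExact x rfl (hA _)
  rw [hB y, Abelian.Ext.zero_comp]

theorem ext_left {n : ℕ} (hD : ExtZero R X D n) (hB : ExtZero R X B (n + 1)) :
    ExtZero R X A (n + 1) := by
  rw [extZero_iff] at *
  intro x
  obtain ⟨y, rfl⟩ := Abelian.Ext.covariant_sequence_exact₁ _ h.shortExact x (hB _) rfl
  rw [hD y, Abelian.Ext.zero_comp]

/-- The kernel of `Ext¹(X, A) → Ext¹(X, B)` consists of the connecting images of maps `X → D`, and a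
map that lifts to `B` has connecting image zero. -/
theorem ext_left_one (hs : ∀ φ : X →ₗ[R] D, ∃ ψ : X →ₗ[R] B, g ∘ₗ ψ = φ)
    (hB : ExtZero R X B 1) : ExtZero R X A 1 := by
  rw [extZero_iff] at *
  intro x
  obtain ⟨y, rfl⟩ := Abelian.Ext.covariant_sequence_exact₁ _ h.shortExact x (hB _)
    (zero_add 1)
  obtain ⟨φ, rfl⟩ := Abelian.Ext.homEquiv₀.symm.surjective y
  obtain ⟨ψ, hψ⟩ := hs φ.hom
  have : φ = ModuleCat.ofHom ψ ≫ ModuleCat.ofHom g := by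
    ext x; simp [← hψ]
  subst this
  have h3 := Abelian.Ext.mk₀_comp_mk₀ (ModuleCat.ofHom ψ) (ModuleCat.ofHom g)
  change (Abelian.Ext.mk₀ (ModuleCat.ofHom ψ ≫ ModuleCat.ofHom g)).comp _ _ = 0
  rw [← h3, Abelian.Ext.comp_assoc_of_second_deg_zero]
  exact ext_comp_eq_zero_of_right _ h.shortExact.comp_extClass _

/-- The obstruction to lifting `φ` is its connecting image in `Ext¹(X, A)`. -/
theorem exists_lift (hA : ExtZero R X A 1) (φ : X →ₗ[R] D) :
    ∃ ψ : X →ₗ[R] B, g ∘ₗ ψ = φ := by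
  rw [extZero_iff] at hA
  obtain ⟨y, hy⟩ := Abelian.Ext.covariant_sequence_exact₃ _ h.shortExact
    (Abelian.Ext.mk₀ (ModuleCat.ofHom φ)) (zero_add 1) (hA _)
  obtain ⟨ψ, rfl⟩ := Abelian.Ext.homEquiv₀.symm.surjective y
  refine ⟨ψ.hom, ?_⟩
  have h3 := (Abelian.Ext.mk₀_comp_mk₀ ψ (ModuleCat.ofHom g)).symm.trans hy
  have h4 := Abelian.Ext.homEquiv₀.symm.injective h3
  exact congrArg ModuleCat.Hom.hom h4

theorem ext_mid' {n : ℕ} (hA : ExtZero R A Y n) (hD : ExtZero R D Y n) : ExtZero R B Y n := by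
  rw [extZero_iff] at *
  intro x
  obtain ⟨y, rfl⟩ := Abelian.Ext.contravariant_sequence_exact₂ h.shortExact _ x (hA _)
  exact ext_comp_eq_zero_of_right _ (hD y) _

theorem ext_left' {n : ℕ} (hB : ExtZero R B Y n) (hD : ExtZero R D Y (n + 1)) :
    ExtZero R A Y n := by
  rw [extZero_iff] at *
  intro x
  obtain ⟨y, rfl⟩ := Abelian.Ext.contravariant_sequence_exact₁ h.shortExact _ x
    (add_comm 1 n) (hD _)
  exact ext_comp_eq_zero_of_right _ (hB y) _

theorem ext_right' {n : ℕ} (hA : ExtZero R A Y n) (hB : ExtZero R B Y (n + 1)) :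
    ExtZero R D Y (n + 1) := by
  rw [extZero_iff] at *
  intro x
  obtain ⟨y, rfl⟩ := Abelian.Ext.contravariant_sequence_exact₃ h.shortExact _ x (hB _)
    (add_comm 1 n)
  exact ext_comp_eq_zero_of_right _ (hA y) _

theorem ext_right_one' (hs : ∀ φ : A →ₗ[R] Y, ∃ ψ : B →ₗ[R] Y, ψ ∘ₗ f = φ)
    (hB : ExtZero R B Y 1) : ExtZero R D Y 1 := by
  rw [extZero_iff] at *
  intro x
  obtain ⟨y, rfl⟩ := Abelian.Ext.contravariant_sequence_exact₃ h.shortExact _ x (hB _)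
    (add_zero 1)
  obtain ⟨φ, rfl⟩ := Abelian.Ext.homEquiv₀.symm.surjective y
  obtain ⟨ψ, hψ⟩ := hs φ.hom
  have : φ = ModuleCat.ofHom f ≫ ModuleCat.ofHom ψ := by
    ext x; simp [← hψ]
  subst this
  have h3 := Abelian.Ext.mk₀_comp_mk₀ (ModuleCat.ofHom f) (ModuleCat.ofHom ψ)
  change Abelian.Ext.comp _ (Abelian.Ext.mk₀ (ModuleCat.ofHom f ≫ ModuleCat.ofHom ψ)) _ = 0
  rw [← h3, ← Abelian.Ext.comp_assoc_of_second_deg_zero]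
  exact ext_comp_eq_zero_of_left h.shortExact.extClass_comp _ _

theorem exists_extend (hD : ExtZero R D Y 1) (φ : A →ₗ[R] Y) :
    ∃ ψ : B →ₗ[R] Y, ψ ∘ₗ f = φ := by
  rw [extZero_iff] at hD
  obtain ⟨y, hy⟩ := Abelian.Ext.contravariant_sequence_exact₁ h.shortExact _
    (Abelian.Ext.mk₀ (ModuleCat.ofHom φ)) (add_zero 1) (hD _)
  obtain ⟨ψ, rfl⟩ := Abelian.Ext.homEquiv₀.symm.surjective y
  refine ⟨ψ.hom, ?_⟩
  have h3 := (Abelian.Ext.mk₀_comp_mk₀ (ModuleCat.ofHom f) ψ).symm.trans hy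
  have h4 := Abelian.Ext.homEquiv₀.symm.injective h3
  exact congrArg ModuleCat.Hom.hom h4

end IsSES

end Ext

end RelHom

/-! ### Resolutions, and Ext computed from them -/

namespace RelHom

section Factor

variable {R : Type u} [CommRing R]
variable {A B D T : Type*} [AddCommGroup A] [Module R A] [AddCommGroup B] [Module R B]
  [AddCommGroup D] [Module R D] [AddCommGroup T] [Module R T]

theorem exists_comp_eq_of_surjective {f : A →ₗ[R] B} {g : B →ₗ[R] D} (hfg : Function.Exact f g)
    (hg : Function.Surjective g) (φ : B →ₗ[R] T) (hφ : φ ∘ₗ f = 0) :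
    ∃ ψ : D →ₗ[R] T, ψ ∘ₗ g = φ := by
  have hk : LinearMap.ker g ≤ LinearMap.ker φ := by
    intro x hx
    obtain ⟨y, rfl⟩ := (hfg x).1 hx
    exact LinearMap.congr_fun hφ y
  refine ⟨(LinearMap.ker g).liftQ φ hk ∘ₗ (g.quotKerEquivOfSurjective hg).symm.toLinearMap, ?_⟩
  ext x
  have : (g.quotKerEquivOfSurjective hg).symm (g x) = (LinearMap.ker g).mkQ x := by
    rw [LinearEquiv.symm_apply_eq]; rfl
  simp [this]

theorem exists_comp_eq_of_injective {f : A →ₗ[R] B} {g : B →ₗ[R] D} (hfg : Function.Exact f g)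
    (hf : Function.Injective f) (φ : T →ₗ[R] B) (hφ : g ∘ₗ φ = 0) :
    ∃ ψ : T →ₗ[R] A, f ∘ₗ ψ = φ := by
  refine ⟨(LinearEquiv.ofInjective f hf).symm.toLinearMap ∘ₗ
    φ.codRestrict (LinearMap.range f) fun x => (hfg (φ x)).1 (LinearMap.congr_fun hφ x), ?_⟩
  ext x
  have := (LinearEquiv.ofInjective f hf).apply_symm_apply
    (φ.codRestrict (LinearMap.range f) (fun x => (hfg (φ x)).1 (LinearMap.congr_fun hφ x)) x)
  exact congrArg Subtype.val this

end Factor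

variable {R : Type u} [CommRing R]

theorem isSES_ker {A B : Type u} [AddCommGroup A] [Module R A] [AddCommGroup B] [Module R B]
    (g : A →ₗ[R] B) (hg : Function.Surjective g) : IsSES (LinearMap.ker g).subtype g :=
  ⟨Subtype.val_injective, LinearMap.exact_subtype_ker_map g, hg⟩

theorem isSES_range {A B : Type u} [AddCommGroup A] [Module R A] [AddCommGroup B] [Module R B]
    (f : A →ₗ[R] B) (hf : Function.Injective f) : IsSES f (LinearMap.range f).mkQ :=
  ⟨hf, LinearMap.exact_map_mkQ_range f, Submodule.mkQ_surjective _⟩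

/-- The class of projective modules. -/
def projectiveClass : ObjectProperty (ModuleCat.{u} R) := fun X => Module.Projective R X

/-- The class of injective modules. -/
def injectiveClass : ObjectProperty (ModuleCat.{u} R) := fun X => Module.Injective R X

variable {𝒳 : ObjectProperty (ModuleCat.{u} R)}

namespace Resolution

variable {M : ModuleCat.{u} R} (r : Resolution 𝒳 M)

/-- The map onto the first syzygy. -/
def toKer : r.X 1 →ₗ[R] LinearMap.ker r.ε :=
  (r.d 0).codRestrict _ r.exact_zero.apply_apply_eq_zero

theorem toKer_surjective : Function.Surjective r.toKer := by
  rintro ⟨x, hx⟩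
  obtain ⟨y, rfl⟩ := (r.exact_zero x).1 hx
  exact ⟨y, rfl⟩

theorem toKer_exact : Function.Exact (r.d 1) r.toKer := by
  intro x
  rw [← r.exact 0 x, Subtype.ext_iff]
  rfl

/-- The resolution of the first syzygy. -/
def tail : Resolution 𝒳 (ModuleCat.of R (LinearMap.ker r.ε)) where
  X n := r.X (n + 1)
  mem n := r.mem (n + 1)
  d n := r.d (n + 1)
  ε := r.toKer
  exact n := r.exact (n + 1)
  exact_zero := r.toKer_exact
  surjective := r.toKer_surjective

theorem isSES : IsSES (LinearMap.ker r.ε).subtype r.ε := isSES_ker _ r.surjective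

/-- Ext is the cohomology of `Hom(r, T)`: passing to the first syzygy lowers the degree, and in
degree one a cocycle is a map out of the syzygy, to be extended to `r.X 0`. Abstract Ext groups are
thereby replaced by extension problems for explicit maps. -/
theorem extZero_iff {M : ModuleCat.{u} R} (r : Resolution projectiveClass M) (T : Type u)
    [AddCommGroup T] [Module R T] (n : ℕ) :
    ExtZero R M T (n + 1) ↔
      ∀ φ : r.X (n + 1) →ₗ[R] T, φ ∘ₗ r.d (n + 1) = 0 → ∃ ψ : r.X n →ₗ[R] T, ψ ∘ₗ r.d n = φ := by
  induction n generalizing M with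
  | zero =>
    have := r.mem 0
    have : Module.Projective R (r.X 0) := this
    constructor
    · intro h φ hφ
      obtain ⟨φ', rfl⟩ := exists_comp_eq_of_surjective r.toKer_exact r.toKer_surjective φ hφ
      obtain ⟨ψ, rfl⟩ := r.isSES.exists_extend h φ'
      exact ⟨ψ, rfl⟩
    · intro h
      refine r.isSES.ext_right_one' (fun φ => ?_) (ExtZero.of_projective 0)
      obtain ⟨ψ, hψ⟩ := h (φ ∘ₗ r.toKer) (by
        rw [LinearMap.comp_assoc, r.toKer_exact.linearMap_comp_eq_zero, LinearMap.comp_zero])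
      refine ⟨ψ, LinearMap.ext fun x => ?_⟩
      obtain ⟨y, rfl⟩ := r.toKer_surjective x
      exact LinearMap.congr_fun hψ y
  | succ n ih =>
    have : Module.Projective R (r.X 0) := r.mem 0
    have h1 : ExtZero R M T (n + 1 + 1) ↔ ExtZero R (LinearMap.ker r.ε) T (n + 1) :=
      ⟨fun h => r.isSES.ext_left' (ExtZero.of_projective n) h,
        fun h => r.isSES.ext_right' h (ExtZero.of_projective (n + 1))⟩
    exact h1.trans (ih r.tail)

end Resolution

namespace Coresolution

variable {M : ModuleCat.{u} R} (r : Coresolution 𝒳 M)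

/-- The map onto the first cosyzygy. -/
def toKer : r.X 0 →ₗ[R] LinearMap.ker (r.d 1) :=
  (r.d 0).codRestrict _ (r.exact 0).apply_apply_eq_zero

theorem toKer_surjective : Function.Surjective r.toKer := by
  rintro ⟨x, hx⟩
  obtain ⟨y, rfl⟩ := (r.exact 0 x).1 hx
  exact ⟨y, rfl⟩

theorem toKer_exact : Function.Exact r.ε r.toKer := by
  intro x
  rw [← r.exact_zero x, Subtype.ext_iff]
  rfl

/-- The coresolution of the first cosyzygy. -/
def tail : Coresolution 𝒳 (ModuleCat.of R (LinearMap.ker (r.d 1))) where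
  X n := r.X (n + 1)
  mem n := r.mem (n + 1)
  d n := r.d (n + 1)
  ε := (LinearMap.ker (r.d 1)).subtype
  exact n := r.exact (n + 1)
  exact_zero := LinearMap.exact_subtype_ker_map _
  injective := Subtype.val_injective

theorem isSES : IsSES r.ε r.toKer := ⟨r.injective, r.toKer_exact, r.toKer_surjective⟩

theorem extZero_iff {M : ModuleCat.{u} R} (r : Coresolution injectiveClass M) (T : Type u)
    [AddCommGroup T] [Module R T] (n : ℕ) :
    ExtZero R T M (n + 1) ↔
      ∀ φ : T →ₗ[R] r.X (n + 1), r.d (n + 1) ∘ₗ φ = 0 → ∃ ψ : T →ₗ[R] r.X n, r.d n ∘ₗ ψ = φ := by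
  induction n generalizing M with
  | zero =>
    have : Module.Injective R (r.X 0) := r.mem 0
    constructor
    · intro h φ hφ
      obtain ⟨φ', rfl⟩ := exists_comp_eq_of_injective
        (LinearMap.exact_subtype_ker_map (r.d 1)) Subtype.val_injective φ hφ
      obtain ⟨ψ, rfl⟩ := r.isSES.exists_lift h φ'
      exact ⟨ψ, rfl⟩
    · intro h
      refine r.isSES.ext_left_one (fun φ => ?_) (ExtZero.of_injective 0)
      obtain ⟨ψ, hψ⟩ := h ((LinearMap.ker (r.d 1)).subtype ∘ₗ φ) (by ext x; simp)
      exact ⟨ψ, LinearMap.ext fun x => Subtype.ext (LinearMap.congr_fun hψ x)⟩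
  | succ n ih =>
    have : Module.Injective R (r.X 0) := r.mem 0
    have h1 : ExtZero R T M (n + 1 + 1) ↔ ExtZero R T (LinearMap.ker (r.d 1)) (n + 1) :=
      ⟨fun h => r.isSES.ext_right (ExtZero.of_injective n) h,
        fun h => r.isSES.ext_left h (ExtZero.of_injective (n + 1))⟩
    exact h1.trans (ih r.tail)

end Coresolution

/-! ### Finite resolutions as iterated short exact sequences, and relative dimensions -/

/-- `M` has an `𝒳`-resolution with at most `n` nonzero terms. -/
def FinRes (𝒳 : ObjectProperty (ModuleCat.{u} R)) : ℕ → ModuleCat.{u} R → Prop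
  | 0, M => Subsingleton M
  | n + 1, M => ∃ (K X : ModuleCat.{u} R) (f : K →ₗ[R] X) (g : X →ₗ[R] M),
      𝒳 X ∧ FinRes 𝒳 n K ∧ IsSES f g

/-- `M` has an `𝒳`-coresolution with at most `n` nonzero terms. -/
def FinCores (𝒳 : ObjectProperty (ModuleCat.{u} R)) : ℕ → ModuleCat.{u} R → Prop
  | 0, M => Subsingleton M
  | n + 1, M => ∃ (X K : ModuleCat.{u} R) (f : M →ₗ[R] X) (g : X →ₗ[R] K),
      𝒳 X ∧ FinCores 𝒳 n K ∧ IsSES f g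

theorem IsSES.congr_right {A B D D' : Type u} [AddCommGroup A] [Module R A] [AddCommGroup B]
    [Module R B] [AddCommGroup D] [Module R D] [AddCommGroup D'] [Module R D'] {f : A →ₗ[R] B}
    {g : B →ₗ[R] D} (h : IsSES f g) (e : D ≃ₗ[R] D') : IsSES f (e.toLinearMap ∘ₗ g) :=
  ⟨h.inj, fun x => by simpa using h.exact x, e.surjective.comp h.surj⟩

theorem IsSES.congr_left {A A' B D : Type u} [AddCommGroup A] [Module R A] [AddCommGroup A']
    [Module R A'] [AddCommGroup B] [Module R B] [AddCommGroup D] [Module R D] {f : A →ₗ[R] B}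
    {g : B →ₗ[R] D} (h : IsSES f g) (e : A' ≃ₗ[R] A) : IsSES (f ∘ₗ e.toLinearMap) g :=
  ⟨h.inj.comp e.injective, fun x => by rw [h.exact x]; simp [e.surjective.range_comp], h.surj⟩

theorem FinRes.congr {n : ℕ} {M M' : ModuleCat.{u} R} (h : FinRes 𝒳 n M) (e : M ≃ₗ[R] M') :
    FinRes 𝒳 n M' := by
  cases n with
  | zero =>
    have : Subsingleton M := h
    exact e.symm.injective.subsingleton
  | succ n =>
    obtain ⟨K, X, f, g, hX, hK, hs⟩ := h
    exact ⟨K, X, f, _, hX, hK, hs.congr_right e⟩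

theorem FinCores.congr {n : ℕ} {M M' : ModuleCat.{u} R} (h : FinCores 𝒳 n M) (e : M ≃ₗ[R] M') :
    FinCores 𝒳 n M' := by
  cases n with
  | zero =>
    have : Subsingleton M := h
    exact e.symm.injective.subsingleton
  | succ n =>
    obtain ⟨X, K, f, g, hX, hK, hs⟩ := h
    exact ⟨X, K, _, g, hX, hK, hs.congr_left e.symm⟩

/-- The strict bound treats the value `⊥` of the zero sequence like any finite length, and `n` then
counts terms, as in `FinRes` and `FinCores`. -/
theorem seqLength_lt_iff {X : ℕ → ModuleCat.{u} R} {n : ℕ} (hn : 0 < n) :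
    seqLength X < (n : ℕ∞) ↔ ∀ i, n ≤ i → Subsingleton (X i) := by
  obtain ⟨m, rfl⟩ := Nat.exists_eq_succ_of_ne_zero hn.ne'
  have hl : ∀ k : ℕ, ((k : ℕ∞) : WithBot ℕ∞) ≤ ((m : ℕ∞) : WithBot ℕ∞) ↔ k < m + 1 := by
    intro k
    rw [WithBot.coe_le_coe, Nat.cast_le, Nat.lt_succ_iff]
  constructor
  · intro h i hi
    by_contra hX
    rw [not_subsingleton_iff_nontrivial] at hX
    have h1 : ((i : ℕ∞) : WithBot ℕ∞) ≤ seqLength X :=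
      le_iSup₂ (f := fun (k : ℕ) (_ : Nontrivial (X k)) => ((k : ℕ∞) : WithBot ℕ∞)) i hX
    have h2 := h1.trans_lt h
    rw [WithBot.coe_lt_coe, Nat.cast_lt] at h2
    omega
  · intro h
    have h1 : seqLength X ≤ ((m : ℕ∞) : WithBot ℕ∞) := by
      refine iSup₂_le fun i hi => (hl i).2 ?_
      by_contra hc
      exact not_subsingleton_iff_nontrivial.2 hi (h i (not_lt.1 hc))
    refine h1.trans_lt ?_
    rw [WithBot.coe_lt_coe, Nat.cast_lt]
    exact Nat.lt_succ_self m

theorem exists_nat_of_lt_top {a : WithBot ℕ∞} (h : a < ⊤) :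
    ∃ n : ℕ, 0 < n ∧ a < ((n : ℕ∞) : WithBot ℕ∞) := by
  induction a using WithBot.recBotCoe with
  | bot => exact ⟨1, one_pos, WithBot.bot_lt_coe _⟩
  | coe a =>
    have h' : a < ⊤ := WithBot.coe_lt_coe.1 h
    lift a to ℕ using h'.ne
    exact ⟨a + 1, a.succ_pos, by rw [WithBot.coe_lt_coe, Nat.cast_lt]; exact a.lt_succ_self⟩

theorem coe_nat_lt_top (n : ℕ) : ((n : ℕ∞) : WithBot ℕ∞) < ⊤ :=
  WithBot.coe_lt_coe.2 (ENat.natCast_lt_top n)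

theorem Resolution.finRes {n : ℕ} {M : ModuleCat.{u} R} (r : Resolution 𝒳 M)
    (h : ∀ i, n ≤ i → Subsingleton (r.X i)) : FinRes 𝒳 n M := by
  induction n generalizing M with
  | zero =>
    have := h 0 le_rfl
    exact r.surjective.subsingleton
  | succ n ih =>
    exact ⟨_, _, _, _, r.mem 0, ih r.tail fun i hi => h (i + 1) (by omega), r.isSES⟩

theorem Coresolution.finCores {n : ℕ} {M : ModuleCat.{u} R} (r : Coresolution 𝒳 M)
    (h : ∀ i, n ≤ i → Subsingleton (r.X i)) : FinCores 𝒳 n M := by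
  induction n generalizing M with
  | zero =>
    have := h 0 le_rfl
    exact r.injective.subsingleton
  | succ n ih =>
    exact ⟨_, _, _, _, r.mem 0, ih r.tail fun i hi => h (i + 1) (by omega), r.isSES⟩

/-- Splices a resolution of `K` with a short exact sequence `0 → K → X → M → 0`. -/
def Resolution.cons {M K X : ModuleCat.{u} R} {f : K →ₗ[R] X} {g : X →ₗ[R] M} (hX : 𝒳 X)
    (h : IsSES f g) (r : Resolution 𝒳 K) : Resolution 𝒳 M where
  X | 0 => X
    | n + 1 => r.X n
  mem | 0 => hX
      | n + 1 => r.mem n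
  d | 0 => f ∘ₗ r.ε
    | n + 1 => r.d n
  ε := g
  exact | 0 => fun x => by
            rw [← r.exact_zero x]
            exact (map_eq_zero_iff f h.inj)
        | n + 1 => r.exact n
  exact_zero x := by
    rw [h.exact x]
    exact Set.ext_iff.1 (r.surjective.range_comp f).symm x
  surjective := h.surj

/-- Splices a coresolution of `K` with a short exact sequence `0 → M → X → K → 0`. -/
def Coresolution.cons {M K X : ModuleCat.{u} R} {f : M →ₗ[R] X} {g : X →ₗ[R] K} (hX : 𝒳 X)
    (h : IsSES f g) (r : Coresolution 𝒳 K) : Coresolution 𝒳 M where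
  X | 0 => X
    | n + 1 => r.X n
  mem | 0 => hX
      | n + 1 => r.mem n
  d | 0 => r.ε ∘ₗ g
    | n + 1 => r.d n
  ε := f
  exact | 0 => fun x => by
            rw [r.exact_zero x]
            exact Set.ext_iff.1 (h.surj.range_comp r.ε).symm x
        | n + 1 => r.exact n
  exact_zero x := by
    rw [← h.exact x]
    exact (map_eq_zero_iff r.ε r.injective)
  injective := h.inj

theorem FinRes.exists_resolution (h0 : ∀ Z : ModuleCat.{u} R, Subsingleton Z → 𝒳 Z) {n : ℕ}
    {M : ModuleCat.{u} R} (h : FinRes 𝒳 n M) :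
    ∃ r : Resolution 𝒳 M, ∀ i, n ≤ i → Subsingleton (r.X i) := by
  induction n generalizing M with
  | zero =>
    have : Subsingleton M := h
    exact ⟨⟨fun _ => M, fun _ => h0 M h, fun _ => 0, 0,
      fun n x => ⟨fun _ => ⟨0, Subsingleton.elim _ _⟩, fun _ => Subsingleton.elim _ _⟩,
      fun x => ⟨fun _ => ⟨0, Subsingleton.elim _ _⟩, fun _ => Subsingleton.elim _ _⟩,
      Function.surjective_to_subsingleton _⟩, fun _ _ => h⟩
  | succ n ih =>
    obtain ⟨K, X, f, g, hX, hK, hs⟩ := h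
    obtain ⟨r, hr⟩ := ih hK
    refine ⟨r.cons hX hs, fun i hi => ?_⟩
    obtain ⟨j, rfl⟩ := Nat.exists_eq_add_of_le' (show 1 ≤ i by omega)
    exact hr j (by omega)

theorem FinCores.exists_coresolution (h0 : ∀ Z : ModuleCat.{u} R, Subsingleton Z → 𝒳 Z) {n : ℕ}
    {M : ModuleCat.{u} R} (h : FinCores 𝒳 n M) :
    ∃ r : Coresolution 𝒳 M, ∀ i, n ≤ i → Subsingleton (r.X i) := by
  induction n generalizing M with
  | zero =>
    have : Subsingleton M := h
    exact ⟨⟨fun _ => M, fun _ => h0 M h, fun _ => 0, 0,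
      fun n x => ⟨fun _ => ⟨0, Subsingleton.elim _ _⟩, fun _ => Subsingleton.elim _ _⟩,
      fun x => ⟨fun _ => ⟨0, Subsingleton.elim _ _⟩, fun _ => Subsingleton.elim _ _⟩,
      Function.injective_of_subsingleton _⟩, fun _ _ => h⟩
  | succ n ih =>
    obtain ⟨K, X, f, g, hX, hK, hs⟩ := h
    obtain ⟨r, hr⟩ := ih hK
    refine ⟨r.cons hX hs, fun i hi => ?_⟩
    obtain ⟨j, rfl⟩ := Nat.exists_eq_add_of_le' (show 1 ≤ i by omega)
    exact hr j (by omega)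

theorem finRes_of_relProjDim_lt {M : ModuleCat.{u} R} {n : ℕ} (hn : 0 < n)
    (h : relProjDim 𝒳 M < (n : ℕ∞)) : FinRes 𝒳 n M := by
  obtain ⟨r, hr⟩ := iInf_lt_iff.1 h
  exact r.finRes ((seqLength_lt_iff hn).1 hr)

theorem finCores_of_relInjDim_lt {M : ModuleCat.{u} R} {n : ℕ} (hn : 0 < n)
    (h : relInjDim 𝒳 M < (n : ℕ∞)) : FinCores 𝒳 n M := by
  obtain ⟨r, hr⟩ := iInf_lt_iff.1 h
  exact r.finCores ((seqLength_lt_iff hn).1 hr)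

/-- A `Resolution` never stops, so a finite one is padded with zero modules; `h0` puts these in the
class. -/
theorem relProjDim_lt_top_iff (h0 : ∀ Z : ModuleCat.{u} R, Subsingleton Z → 𝒳 Z)
    {M : ModuleCat.{u} R} : relProjDim 𝒳 M < ⊤ ↔ ∃ n, FinRes 𝒳 n M := by
  constructor
  · intro h
    obtain ⟨n, hn, hlt⟩ := exists_nat_of_lt_top h
    exact ⟨n, finRes_of_relProjDim_lt hn hlt⟩
  · rintro ⟨n, h⟩
    obtain ⟨r, hr⟩ := h.exists_resolution h0
    exact (iInf_le _ r).trans_lt (((seqLength_lt_iff n.succ_pos).2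
      fun i hi => hr i (by omega)).trans (coe_nat_lt_top _))

theorem relInjDim_lt_top_iff (h0 : ∀ Z : ModuleCat.{u} R, Subsingleton Z → 𝒳 Z)
    {M : ModuleCat.{u} R} : relInjDim 𝒳 M < ⊤ ↔ ∃ n, FinCores 𝒳 n M := by
  constructor
  · intro h
    obtain ⟨n, hn, hlt⟩ := exists_nat_of_lt_top h
    exact ⟨n, finCores_of_relInjDim_lt hn hlt⟩
  · rintro ⟨n, h⟩
    obtain ⟨r, hr⟩ := h.exists_coresolution h0
    exact (iInf_le _ r).trans_lt (((seqLength_lt_iff n.succ_pos).2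
      fun i hi => hr i (by omega)).trans (coe_nat_lt_top _))

theorem exists_finRes_of_gcProjGlobalDim {C : ModuleCat.{u} R} (h : gcProjGlobalDim C < ⊤) :
    ∃ n, ∀ M, FinRes (IsGCProjective C) n M := by
  obtain ⟨n, hn, hlt⟩ := exists_nat_of_lt_top h
  exact ⟨n, fun M => finRes_of_relProjDim_lt hn
    ((le_iSup (fun M => relProjDim (IsGCProjective C) M) M).trans_lt hlt)⟩

theorem exists_finCores_of_gcInjGlobalDim {C : ModuleCat.{u} R} (h : gcInjGlobalDim C < ⊤) :
    ∃ n, ∀ M, FinCores (IsGCInjective C) n M := by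
  obtain ⟨n, hn, hlt⟩ := exists_nat_of_lt_top h
  exact ⟨n, fun M => finCores_of_relInjDim_lt hn
    ((le_iSup (fun M => relInjDim (IsGCInjective C) M) M).trans_lt hlt)⟩

end RelHom

/-! ### Finitely generated projective resolutions, evaluation maps and character modules -/

namespace RelHom

variable {R : Type u} [CommRing R]

/-- The class of finitely generated projective modules. -/
def finProjectiveClass : ObjectProperty (ModuleCat.{u} R) :=
  fun X => Module.Projective R X ∧ Module.Finite R X

/-- Enlarges the class of the terms of a resolution. -/
def Resolution.mono {𝒳 𝒴 : ObjectProperty (ModuleCat.{u} R)} (h : ∀ X, 𝒳 X → 𝒴 X)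
    {M : ModuleCat.{u} R} (r : Resolution 𝒳 M) : Resolution 𝒴 M where
  X := r.X
  mem n := h _ (r.mem n)
  d := r.d
  ε := r.ε
  exact := r.exact
  exact_zero := r.exact_zero
  surjective := r.surjective

theorem exists_resolution_of_projectiveResolution {𝒳 : ObjectProperty (ModuleCat.{u} R)}
    {C : ModuleCat.{u} R} (P : ProjectiveResolution C) (h : ∀ n, 𝒳 (P.complex.X n)) :
    Nonempty (Resolution 𝒳 C) := by
  refine ⟨⟨P.complex.X, h, fun n => (P.complex.d (n + 1) n).hom,
    (show P.complex.X 0 ⟶ C from P.π.f 0).hom, fun n => ?_, ?_, ?_⟩⟩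
  · exact (ShortComplex.ShortExact.moduleCat_exact_iff_function_exact _).1 (P.exact_succ n)
  · exact (ShortComplex.ShortExact.moduleCat_exact_iff_function_exact _).1 P.exact₀
  · exact (ModuleCat.epi_iff_surjective _).1 (inferInstance : Epi (P.π.f 0))

theorem IsSemidualizing.exists_finProj {C : ModuleCat.{u} R} (hC : IsSemidualizing C) :
    Nonempty (Resolution finProjectiveClass C) := by
  obtain ⟨P, hP⟩ := hC.exists_resolution
  exact exists_resolution_of_projectiveResolution P fun n =>
    ⟨(IsProjective.iff_projective _).2 (P.projective n), hP n⟩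

/-- A resolution by finitely generated projective modules, as a projective resolution. -/
def Resolution.toProjective {C : ModuleCat.{u} R} (r : Resolution finProjectiveClass C) :
    Resolution projectiveClass C :=
  r.mono fun _ h => h.1

theorem Resolution.extZero_iff_of_finProjective {C : ModuleCat.{u} R}
    (r : Resolution finProjectiveClass C) (T : Type u) [AddCommGroup T] [Module R T] (n : ℕ) :
    ExtZero R C T (n + 1) ↔
      ∀ φ : r.X (n + 1) →ₗ[R] T, φ ∘ₗ r.d (n + 1) = 0 → ∃ ψ : r.X n →ₗ[R] T, ψ ∘ₗ r.d n = φ :=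
  r.toProjective.extZero_iff T n

section Evaluation

variable {R : Type*} [CommRing R]
variable (F N I : Type*) [AddCommGroup F] [Module R F] [AddCommGroup N] [Module R N]
  [AddCommGroup I] [Module R I]

/-- The tensor evaluation map `F ⊗ Hom(N, I) → Hom(Hom(F, N), I)`. -/
noncomputable def tensorEval : F ⊗[R] (N →ₗ[R] I) →ₗ[R] ((F →ₗ[R] N) →ₗ[R] I) :=
  TensorProduct.lift
    { toFun := fun x =>
        { toFun := fun f => f ∘ₗ LinearMap.applyₗ x
          map_add' := fun f g => by ext; simp
          map_smul' := fun a f => by ext; simp }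
      map_add' := fun x y => by ext; simp
      map_smul' := fun a x => by ext; simp }

variable {F N I}

@[simp] theorem tensorEval_tmul (x : F) (f : N →ₗ[R] I) (g : F →ₗ[R] N) :
    tensorEval F N I (x ⊗ₜ f) g = f (g x) := rfl

variable (F N I) in
-- A retraction `p ∘ q = id` of `F` from `Rⁿ` gives a dual basis `p eᵢ`, `qᵢ`. The inverse sends `Φ`
-- to `∑ p eᵢ ⊗ (Φ ∘ vᵢ)`, where `vᵢ m` is the map `x ↦ qᵢ(x) m`.
theorem tensorEval_bijective [Module.Projective R F] [Module.Finite R F] :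
    Function.Bijective (tensorEval (R := R) F N I) := by
  obtain ⟨n, p, q, -, -, hpq⟩ := Module.Finite.exists_comp_eq_id_of_projective R F
  have hsum : ∀ x : F, ∑ i, q x i • p (Pi.single i 1) = x := by
    intro x
    have hx : ∑ i, q x i • Pi.single i (1 : R) = q x := by
      ext j; simp [Finset.sum_apply, Pi.single_apply]
    simp only [← map_smul, ← map_sum, hx]
    exact LinearMap.congr_fun hpq x
  let v : Fin n → N →ₗ[R] (F →ₗ[R] N) := fun i =>
    LinearMap.smulRightₗ (R := R) (M := N) (M₂ := F) (LinearMap.proj i ∘ₗ q)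
  have hv : ∀ i m x, v i m x = q x i • m := fun i m x => rfl
  let inv : ((F →ₗ[R] N) →ₗ[R] I) → F ⊗[R] (N →ₗ[R] I) := fun Φ =>
    ∑ i, p (Pi.single i 1) ⊗ₜ (Φ ∘ₗ v i)
  have hinv_add : ∀ Φ Ψ, inv (Φ + Ψ) = inv Φ + inv Ψ := fun Φ Ψ => by
    simp only [inv, LinearMap.add_comp, TensorProduct.tmul_add, Finset.sum_add_distrib]
  have hl : Function.LeftInverse inv (tensorEval F N I) := by
    intro z
    induction z with
    | zero => simp [inv]
    | add x y hx hy => rw [map_add, hinv_add, hx, hy]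
    | tmul x f =>
      have : ∀ i, tensorEval F N I (x ⊗ₜ f) ∘ₗ v i = q x i • f := fun i => by
        ext m; simp [hv]
      simp only [inv, this]
      simp only [← TensorProduct.smul_tmul, ← TensorProduct.sum_tmul, hsum]
  have hr : Function.RightInverse inv (tensorEval F N I) := by
    intro Φ
    ext g
    have hg : ∑ i, v i (g (p (Pi.single i 1))) = g := by
      ext x
      simp only [LinearMap.sum_apply, hv, ← map_smul g]
      rw [← map_sum, hsum]
    simp only [inv, map_sum, LinearMap.sum_apply, tensorEval_tmul, LinearMap.comp_apply]
    rw [← map_sum, hg]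
  exact ⟨hl.injective, hr.surjective⟩

theorem tensorEval_naturality {F' : Type*} [AddCommGroup F'] [Module R F'] (d : F' →ₗ[R] F)
    (z : F' ⊗[R] (N →ₗ[R] I)) (g : F →ₗ[R] N) :
    tensorEval F N I (d.rTensor _ z) g = tensorEval F' N I z (g ∘ₗ d) := by
  induction z with
  | zero => simp
  | add x y hx hy => simp only [map_add, LinearMap.add_apply, hx, hy]
  | tmul x f => rfl

end Evaluation

theorem rTensorHom_naturality {C P F F' : Type*} [AddCommGroup C] [Module R C]
    [AddCommGroup P] [Module R P] [AddCommGroup F] [Module R F] [AddCommGroup F']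
    [Module R F'] (d : F' →ₗ[R] F) (z : (F →ₗ[R] C) ⊗[R] P) :
    TensorProduct.rTensorHomToHomRTensor (.id R) F' C P
        ((LinearMap.lcomp R C d).rTensor P z) =
      TensorProduct.rTensorHomToHomRTensor (.id R) F C P z ∘ₗ d := by
  induction z with
  | zero => simp
  | add x y hx hy => simp only [map_add, hx, hy, LinearMap.add_comp]
  | tmul x f => ext; simp

/-- `φ` descends to the range of `g`, and injectivity of `I` extends it from there to `D`;
surjectivity of `g` is not required. -/
theorem exists_extend_of_exact {A B D : Type*} [AddCommGroup A] [Module R A] [AddCommGroup B]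
    [Module R B] [AddCommGroup D] [Module R D] {I : Type u} [AddCommGroup I] [Module R I]
    [Module.Injective R I] {f : A →ₗ[R] B} {g : B →ₗ[R] D} (hfg : Function.Exact f g)
    (φ : B →ₗ[R] I) (hφ : φ ∘ₗ f = 0) : ∃ ψ : D →ₗ[R] I, ψ ∘ₗ g = φ := by
  obtain ⟨φ', rfl⟩ := exists_comp_eq_of_surjective (g := g.rangeRestrict)
    (fun x => by rw [← hfg x, Subtype.ext_iff]; rfl) g.surjective_rangeRestrict φ hφ
  obtain ⟨ψ, rfl⟩ := Module.Injective.extension_property R I _ _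
    (LinearMap.range g).subtype Subtype.val_injective φ'
  exact ⟨ψ, rfl⟩

theorem dual_rTensor_homEquiv {A A' B : Type*} [AddCommGroup A] [Module R A] [AddCommGroup A']
    [Module R A'] [AddCommGroup B] [Module R B] (d : A →ₗ[R] A') (φ : A' →ₗ[R] CharacterModule B) :
    CharacterModule.dual (d.rTensor B) (CharacterModule.homEquiv φ) =
      CharacterModule.homEquiv (φ ∘ₗ d) := by
  apply CharacterModule.homEquiv.symm.injective
  rw [LinearEquiv.symm_apply_apply]
  rfl

theorem exists_character_of_exact {A B D : Type*} [AddCommGroup A] [Module R A] [AddCommGroup B]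
    [Module R B] [AddCommGroup D] [Module R D] {f : A →ₗ[R] B} {g : B →ₗ[R] D}
    (hfg : Function.Exact f g) (φ : CharacterModule B) (hφ : CharacterModule.dual f φ = 0) :
    ∃ ψ : CharacterModule D, CharacterModule.dual g ψ = φ := by
  have hk : (g.rangeRestrict : B →+ LinearMap.range g).ker ≤ AddMonoidHom.ker φ := by
    intro x hx
    have hx' : g x = 0 := congrArg Subtype.val hx
    obtain ⟨y, rfl⟩ := (hfg x).1 hx'
    exact DFunLike.congr_fun hφ y
  let φ' : CharacterModule (LinearMap.range g) :=
    AddMonoidHom.liftOfSurjective (g.rangeRestrict : B →+ LinearMap.range g)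
      g.surjective_rangeRestrict ⟨φ, hk⟩
  have hφ' : ∀ x, φ' (g.rangeRestrict x) = φ x := fun x =>
    AddMonoidHom.liftOfRightInverse_comp_apply _ _ _ ⟨φ, hk⟩ x
  obtain ⟨ψ, hψ⟩ := CharacterModule.dual_surjective_of_injective
    (LinearMap.range g).subtype Subtype.val_injective φ'
  refine ⟨ψ, DFunLike.ext _ _ fun x => ?_⟩
  rw [← hφ' x, ← hψ]
  rfl

/-! ### Unit and counit of the adjunction between `C ⊗ -` and `Hom(C, -)` -/

section Semidualizing

variable {C : ModuleCat.{u} R} (hC : IsSemidualizing C)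

/-- `Tor_i(C, N) = 0` for all `i ≥ 1`, expressed through the character module of `N`. -/
def TorVanish (C : ModuleCat.{u} R) (N : Type u) [AddCommGroup N] [Module R N] : Prop :=
  ∀ n, ExtZero R C (CharacterModule N) (n + 1)

/-- `Ext^i(C, N) = 0` for all `i ≥ 1`. -/
def ExtVanish (C : ModuleCat.{u} R) (N : Type u) [AddCommGroup N] [Module R N] : Prop :=
  ∀ n, ExtZero R C N (n + 1)

variable (C) in
/-- The unit `N → Hom(C, C ⊗ N)`. -/
noncomputable def unit (N : Type u) [AddCommGroup N] [Module R N] :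
    N →ₗ[R] (C →ₗ[R] C ⊗[R] N) :=
  (TensorProduct.mk R C N).flip

variable (C) in
/-- The counit `C ⊗ Hom(C, N) → N`. -/
noncomputable def counit (N : Type u) [AddCommGroup N] [Module R N] :
    C ⊗[R] (C →ₗ[R] N) →ₗ[R] N :=
  TensorProduct.lift LinearMap.applyₗ

@[simp] theorem unit_apply {N : Type u} [AddCommGroup N] [Module R N] (x : N) (c : C) :
    unit C N x c = c ⊗ₜ x := rfl

variable (r : Resolution finProjectiveClass C)

/-- The map `R → Hom(P₀, C)` induced by the homothety map. -/
def homothetyAug : R →ₗ[R] (r.X 0 →ₗ[R] C) :=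
  LinearMap.toSpanSingleton R _ r.ε

@[simp] theorem homothetyAug_apply (a : R) : homothetyAug r a = a • r.ε := rfl

include hC

theorem homothetyAug_injective : Function.Injective (homothetyAug r) := by
  intro a b hab
  refine hC.homothety_bijective.1 (LinearMap.ext fun c => ?_)
  obtain ⟨x, rfl⟩ := r.surjective c
  exact LinearMap.congr_fun hab x

/-- A map `P₀ → C` killing the image of `P₁` is an endomorphism of `C`, hence a homothety. Together
with `homothetyAug_injective` and `lcomp_exact` this makes `0 → R → Hom(P₀, C) → Hom(P₁, C) → ⋯`
exact. -/
theorem homothetyAug_exact :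
    Function.Exact (homothetyAug r) (LinearMap.lcomp R (C : Type u) (r.d 0)) := by
  intro φ
  constructor
  · intro hφ
    obtain ⟨ψ, rfl⟩ := exists_comp_eq_of_surjective r.exact_zero r.surjective φ hφ
    obtain ⟨a, rfl⟩ := hC.homothety_bijective.2 ψ
    exact ⟨a, rfl⟩
  · rintro ⟨a, rfl⟩
    ext x
    simp [r.exact_zero.apply_apply_eq_zero]

theorem lcomp_exact (n : ℕ) :
    Function.Exact (LinearMap.lcomp R (C : Type u) (r.d n))
      (LinearMap.lcomp R (C : Type u) (r.d (n + 1))) := by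
  have h1 := (r.extZero_iff_of_finProjective C n).1 (hC.ext_subsingleton (n + 1) (by omega))
  intro φ
  constructor
  · intro hφ
    obtain ⟨ψ, hψ⟩ := h1 φ hφ
    exact ⟨ψ, hψ⟩
  · rintro ⟨ψ, rfl⟩
    ext x
    simp [(r.exact n).apply_apply_eq_zero]

section Projective

variable (P : Type u) [AddCommGroup P] [Module R P] [Module.Projective R P]

/-- Since the `Pₙ` are finitely generated projective, `Hom(Pₙ, C) ⊗ P ≅ Hom(Pₙ, C ⊗ P)` naturally.
The complex computing Ext is thus an exact complex tensored with the flat module `P`. -/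
theorem extVanish_tensor : ExtVanish C (C ⊗[R] P) := by
  obtain ⟨r⟩ := hC.exists_finProj
  intro n
  refine (r.extZero_iff_of_finProjective _ n).2 fun φ hφ => ?_
  have i1 : ∀ n, Module.Projective R (r.X n) := fun n => (r.mem n).1
  have i2 : ∀ n, Module.Finite R (r.X n) := fun n => (r.mem n).2
  let θ := fun n => rTensorHomEquivHomRTensor R (r.X n) C P
  have hθ : ∀ n z, θ n z = TensorProduct.rTensorHomToHomRTensor (.id R) (r.X n) C P z :=
    fun n z => rTensorHomEquivHomRTensor_apply z
  obtain ⟨z, rfl⟩ := (θ (n + 1)).surjective φ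
  have hz : (LinearMap.lcomp R (C : Type u) (r.d (n + 1))).rTensor P z = 0 := by
    apply (θ (n + 2)).injective
    rw [map_zero, hθ, rTensorHom_naturality, ← hθ]
    exact hφ
  obtain ⟨w, rfl⟩ := (Module.Flat.rTensor_exact P (lcomp_exact hC r n) z).1 hz
  refine ⟨θ n w, ?_⟩
  rw [hθ, hθ, rTensorHom_naturality]

/-- The same isomorphism of complexes at its left end: the kernel of the first differential is `R ⊗
P` on one side and `Hom(C, C ⊗ P)` on the other, and `key` identifies the comparison with the unit.
-/
theorem unit_bijective_of_projective : Function.Bijective (unit C P) := by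
  obtain ⟨r⟩ := hC.exists_finProj
  have i1 : ∀ n, Module.Projective R (r.X n) := fun n => (r.mem n).1
  have i2 : ∀ n, Module.Finite R (r.X n) := fun n => (r.mem n).2
  let θ := fun n => rTensorHomEquivHomRTensor R (r.X n) C P
  have hθ : ∀ n z, θ n z = TensorProduct.rTensorHomToHomRTensor (.id R) (r.X n) C P z :=
    fun n z => rTensorHomEquivHomRTensor_apply z
  have key : ∀ p : P, θ 0 ((homothetyAug r).rTensor P (1 ⊗ₜ p)) = unit C P p ∘ₗ r.ε := by
    intro p
    rw [hθ]
    ext x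
    simp
  constructor
  · intro p q hpq
    have h1 : (homothetyAug r).rTensor P (1 ⊗ₜ p) = (homothetyAug r).rTensor P (1 ⊗ₜ q) :=
      (θ 0).injective (by rw [key, key, hpq])
    exact (TensorProduct.lid R P).symm.injective
      (Module.Flat.rTensor_preserves_injective_linearMap _ (homothetyAug_injective hC r) h1)
  · intro φ
    obtain ⟨z, hz⟩ := (θ 0).surjective (φ ∘ₗ r.ε)
    have hz0 : (LinearMap.lcomp R (C : Type u) (r.d 0)).rTensor P z = 0 := by
      apply (θ 1).injective
      rw [map_zero, hθ, rTensorHom_naturality, ← hθ, hz, LinearMap.comp_assoc,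
        r.exact_zero.linearMap_comp_eq_zero, LinearMap.comp_zero]
    obtain ⟨w, rfl⟩ := (Module.Flat.rTensor_exact P (homothetyAug_exact hC r) z).1 hz0
    obtain ⟨p, rfl⟩ := (TensorProduct.lid R P).symm.surjective w
    refine ⟨p, LinearMap.ext fun c => ?_⟩
    obtain ⟨x, rfl⟩ := r.surjective c
    exact LinearMap.congr_fun ((key p).symm.trans hz) x

end Projective

section Injective

variable (I : Type u) [AddCommGroup I] [Module R I] [Module.Injective R I]

/-- `tensorEval` identifies `Pₙ ⊗ Hom(C, I)` with `Hom(Hom(Pₙ, C), I)`, and `Hom(-, I)` preserves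
the exactness in `lcomp_exact`. -/
theorem rTensor_hom_exact (n : ℕ) :
    Function.Exact ((r.d (n + 1)).rTensor (C →ₗ[R] I)) ((r.d n).rTensor (C →ₗ[R] I)) := by
  have i1 : ∀ n, Module.Projective R (r.X n) := fun n => (r.mem n).1
  have i2 : ∀ n, Module.Finite R (r.X n) := fun n => (r.mem n).2
  intro z
  constructor
  · intro hz
    obtain ⟨Ψ, hΨ⟩ := exists_extend_of_exact (lcomp_exact hC r n) (tensorEval (r.X (n + 1)) C I z)
      (by ext g; exact (tensorEval_naturality _ _ _).symm.trans (by rw [hz]; rfl))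
    obtain ⟨w, rfl⟩ := (tensorEval_bijective (R := R) (r.X (n + 2)) C I).2 Ψ
    refine ⟨w, (tensorEval_bijective (R := R) (r.X (n + 1)) C I).1 (LinearMap.ext fun g => ?_)⟩
    rw [tensorEval_naturality, ← hΨ]
    rfl
  · rintro ⟨w, rfl⟩
    rw [← LinearMap.comp_apply, ← LinearMap.rTensor_comp, (r.exact n).linearMap_comp_eq_zero,
      LinearMap.rTensor_zero, LinearMap.zero_apply]

theorem torVanish_hom : TorVanish C (C →ₗ[R] I) := by
  obtain ⟨r⟩ := hC.exists_finProj
  intro n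
  refine (r.extZero_iff_of_finProjective _ n).2 fun φ hφ => ?_
  obtain ⟨ψ, hψ⟩ := exists_character_of_exact (rTensor_hom_exact hC r I n)
    (CharacterModule.homEquiv φ) (by rw [dual_rTensor_homEquiv, hφ, map_zero])
  obtain ⟨ψ, rfl⟩ := CharacterModule.homEquiv.surjective ψ
  refine ⟨ψ, CharacterModule.homEquiv.injective ?_⟩
  rw [← hψ, dual_rTensor_homEquiv]

theorem counit_bijective_of_injective : Function.Bijective (counit C I) := by
  obtain ⟨r⟩ := hC.exists_finProj
  have i1 : ∀ n, Module.Projective R (r.X n) := fun n => (r.mem n).1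
  have i2 : ∀ n, Module.Finite R (r.X n) := fun n => (r.mem n).2
  have key : ∀ z : r.X 0 ⊗[R] (C →ₗ[R] I),
      counit C I (r.ε.rTensor _ z) = tensorEval (r.X 0) C I z r.ε := by
    intro z
    induction z with
    | zero => simp
    | add x y hx hy => simp only [map_add, LinearMap.add_apply, hx, hy]
    | tmul x f => rfl
  constructor
  · rw [injective_iff_map_eq_zero]
    intro w hw
    obtain ⟨z, rfl⟩ := LinearMap.rTensor_surjective (C →ₗ[R] I) r.surjective w
    rw [key] at hw
    -- By `key`, the functional attached to `z` kills `r.ε`, hence the image of `R` in `Hom(P₀, C)`.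
    -- It therefore factors through `Hom(P₁, C)`, which exhibits `z` as a boundary.
    obtain ⟨Ψ, hΨ⟩ := exists_extend_of_exact (homothetyAug_exact hC r) (tensorEval (r.X 0) C I z)
      (by ext; simpa using hw)
    obtain ⟨w, rfl⟩ := (tensorEval_bijective (R := R) (r.X 1) C I).2 Ψ
    have : z = (r.d 0).rTensor _ w := by
      refine (tensorEval_bijective (R := R) (r.X 0) C I).1 (LinearMap.ext fun g => ?_)
      rw [tensorEval_naturality, ← hΨ]
      rfl
    rw [this, ← LinearMap.comp_apply, ← LinearMap.rTensor_comp,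
      r.exact_zero.linearMap_comp_eq_zero, LinearMap.rTensor_zero, LinearMap.zero_apply]
  · intro i
    -- Extending `1 ↦ i` along `R ↪ Hom(P₀, C)` gives a functional with value `i` at `r.ε`.
    obtain ⟨Ψ, hΨ⟩ := Module.Injective.extension_property R I _ _ (homothetyAug r)
      (homothetyAug_injective hC r) (LinearMap.toSpanSingleton R I i)
    obtain ⟨z, rfl⟩ := (tensorEval_bijective (R := R) (r.X 0) C I).2 Ψ
    refine ⟨r.ε.rTensor _ z, ?_⟩
    rw [key]
    simpa using LinearMap.congr_fun hΨ 1

end Injective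

end Semidualizing

end RelHom

/-! ### Faithfulness of `Hom(C, -)` and `C ⊗ -` -/

namespace RelHom

variable {R : Type u} [CommRing R]

section Faithful

/-- Induction on the number of generators, passing to `C/D` with `D = R v₀`; the annihilator
condition on a single `y` is what survives this passage. If `Ann(v₀)` kills `x` and `a` kills `C/D`,
then `C → D → N`, `c ↦ a c` followed by `v₀ ↦ x`, is zero, so `a x = 0`; induction gives `x = 0`,
which is `claim`. For `j` in `Ann(v₀)` the product `a j` kills `C`, so `a (j y) = 0` and `j y = 0`
by induction; `claim` then applies to `y`. -/
theorem eq_zero_of_forall_hom_eq_zero (n : ℕ) {C N : Type*} [AddCommGroup C] [Module R C]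
    [AddCommGroup N] [Module R N] (v : Fin n → C) (hv : Submodule.span R (Set.range v) = ⊤)
    (h : ∀ φ : C →ₗ[R] N, φ = 0) (y : N) (hy : ∀ a : R, (∀ c : C, a • c = 0) → a • y = 0) :
    y = 0 := by
  induction n generalizing C y with
  | zero =>
    have h0 : ∀ c : C, c = 0 := fun c => by
      have : c ∈ Submodule.span R (Set.range v) := hv ▸ Submodule.mem_top
      simpa using this
    simpa using hy 1 fun c => h0 _
  | succ n ih =>
    let D := Submodule.span R {v 0}
    have hspan : Submodule.span R (Set.range (D.mkQ ∘ v ∘ Fin.succ)) = ⊤ := by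
      have h1 : Submodule.span R (Set.range (D.mkQ ∘ v)) = ⊤ := by
        rw [Set.range_comp, Submodule.span_image, hv, Submodule.map_top, Submodule.range_mkQ]
      rw [eq_top_iff, ← h1, Submodule.span_le]
      rintro _ ⟨i, rfl⟩
      refine Fin.cases ?_ (fun j => ?_) i
      · have : (D.mkQ ∘ v) 0 = 0 :=
          (Submodule.Quotient.mk_eq_zero D).2 (Submodule.mem_span_singleton_self _)
        rw [this]
        exact zero_mem _
      · exact Submodule.subset_span ⟨j, rfl⟩
    have hD : ∀ φ : C ⧸ D →ₗ[R] N, φ = 0 := fun φ => by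
      rw [← LinearMap.cancel_right D.mkQ_surjective, h (φ ∘ₗ D.mkQ), LinearMap.zero_comp]
    have ih' := fun y hy => ih (D.mkQ ∘ v ∘ Fin.succ) hspan hD y hy
    have hmem : ∀ a : R, (∀ c : C ⧸ D, a • c = 0) → ∀ c : C, a • c ∈ D := fun a ha c =>
      (Submodule.Quotient.mk_eq_zero D).1 (ha (D.mkQ c))
    have claim : ∀ x : N, (∀ j : R, j • v 0 = 0 → j • x = 0) → x = 0 := by
      intro x hx
      refine ih' x fun a ha => ?_
      let q : R →ₗ[R] D := (LinearMap.toSpanSingleton R C (v 0)).codRestrict D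
        fun b => Submodule.mem_span_singleton.2 ⟨b, rfl⟩
      have hq : Function.Surjective q := by
        rintro ⟨_, hz⟩
        obtain ⟨b, rfl⟩ := Submodule.mem_span_singleton.1 hz
        exact ⟨b, rfl⟩
      obtain ⟨ψ, hψ⟩ := exists_comp_eq_of_surjective (LinearMap.exact_subtype_ker_map q) hq
        (LinearMap.toSpanSingleton R N x) (by
          ext ⟨j, hj⟩
          exact hx j (congrArg Subtype.val hj))
      have h2 := LinearMap.congr_fun
        (h (ψ ∘ₗ (a • LinearMap.id : C →ₗ[R] C).codRestrict D (hmem a ha))) (v 0)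
      have h3 := LinearMap.congr_fun hψ a
      have h4 : q a = (a • LinearMap.id : C →ₗ[R] C).codRestrict D (hmem a ha) (v 0) := rfl
      rw [LinearMap.comp_apply, h4] at h3
      rw [LinearMap.comp_apply, h3] at h2
      simpa using h2
    refine claim y fun j hj => ih' _ fun a ha => ?_
    rw [smul_smul]
    refine hy _ fun c => ?_
    obtain ⟨t, ht⟩ := Submodule.mem_span_singleton.1 (hmem a ha c)
    rw [mul_comm, mul_smul, ← ht, smul_comm, hj, smul_zero]

variable {C : ModuleCat.{u} R} (hC : IsSemidualizing C)
include hC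

theorem IsSemidualizing.finite : Module.Finite R C := by
  obtain ⟨r⟩ := hC.exists_finProj
  have := (r.mem 0).2
  exact Module.Finite.of_surjective r.ε r.surjective

theorem subsingleton_of_forall_hom_eq_zero {N : Type*} [AddCommGroup N] [Module R N]
    (h : ∀ φ : C →ₗ[R] N, φ = 0) : Subsingleton N := by
  have := hC.finite
  obtain ⟨n, v, hv⟩ := Module.Finite.exists_fin (R := R) (M := C)
  refine subsingleton_of_forall_eq 0 fun y => eq_zero_of_forall_hom_eq_zero n v hv h y ?_
  intro a ha
  have : a = 0 := hC.homothety_bijective.1 (LinearMap.ext fun c => (ha c).trans (zero_smul R c).symm)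
  rw [this, zero_smul]

theorem injective_of_hom_injective {A B : Type*} [AddCommGroup A] [Module R A] [AddCommGroup B]
    [Module R B] (f : A →ₗ[R] B) (h : ∀ φ : C →ₗ[R] A, f ∘ₗ φ = 0 → φ = 0) :
    Function.Injective f := by
  have : Subsingleton (LinearMap.ker f) := by
    refine subsingleton_of_forall_hom_eq_zero hC fun φ => ?_
    have h1 := h ((LinearMap.ker f).subtype ∘ₗ φ) (by ext x; simp)
    ext x
    exact LinearMap.congr_fun h1 x
  rw [← LinearMap.ker_eq_bot]
  exact Submodule.eq_bot_of_subsingleton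

/-- Dualizing turns `C ⊗ -` into `Hom(C, -)` of character modules, and surjectivity into
injectivity. -/
theorem surjective_of_lTensor_surjective {A B : Type*} [AddCommGroup A] [Module R A]
    [AddCommGroup B] [Module R B] (f : A →ₗ[R] B)
    (h : Function.Surjective (f.lTensor C)) : Function.Surjective f := by
  apply CharacterModule.surjective_of_dual_injective
  apply injective_of_hom_injective hC
  intro φ hφ
  apply CharacterModule.homEquiv.injective
  refine CharacterModule.dual_injective_of_surjective _ h ?_
  rw [map_zero, map_zero]
  refine DFunLike.ext _ _ fun z => ?_
  induction z with
  | zero => exact map_zero _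
  | add x y hx hy => exact (map_add _ x y).trans (by rw [hx, hy]; exact (map_add _ x y).symm)
  | tmul c a => exact DFunLike.congr_fun (LinearMap.congr_fun hφ c) a

end Faithful

/-! ### Exactness of `C ⊗ -` and `Hom(C, -)` on short exact sequences -/

section Exact

variable {C : ModuleCat.{u} R}
variable {A B D : Type u} [AddCommGroup A] [Module R A] [AddCommGroup B] [Module R B]
  [AddCommGroup D] [Module R D] {f : A →ₗ[R] B} {g : B →ₗ[R] D} (h : IsSES f g)

theorem TorVanish.congr (hA : TorVanish C A) (e : A ≃ₗ[R] B) : TorVanish C B := fun n =>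
  (hA n).congr_right (CharacterModule.congr e)

theorem ExtVanish.congr (hA : ExtVanish C A) (e : A ≃ₗ[R] B) : ExtVanish C B := fun n =>
  (hA n).congr_right e

theorem ExtVanish.of_injective [Module.Injective R A] : ExtVanish C A := fun n =>
  ExtZero.of_injective n

theorem TorVanish.of_projective [Module.Projective R A] : TorVanish C A := fun n =>
  have : Module.Injective R (CharacterModule A) :=
    Module.Flat.iff_characterModule_injective.1 inferInstance
  ExtZero.of_injective n

theorem ExtVanish.of_subsingleton [Subsingleton A] : ExtVanish C A :=
  have : Module.Injective R A :=
    ⟨fun _ _ _ _ _ _ _ _ _ => ⟨0, fun _ => Subsingleton.elim _ _⟩⟩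
  ExtVanish.of_injective

theorem TorVanish.of_subsingleton [Subsingleton A] : TorVanish C A :=
  TorVanish.of_projective

namespace IsSES

include h

theorem dual : IsSES (CharacterModule.dual g) (CharacterModule.dual f) where
  inj := CharacterModule.dual_injective_of_surjective g h.surj
  exact φ := by
    constructor
    · intro hφ
      exact exists_character_of_exact h.exact φ hφ
    · rintro ⟨ψ, rfl⟩
      rw [← LinearMap.comp_apply, ← CharacterModule.dual_comp,
        h.exact.linearMap_comp_eq_zero, CharacterModule.dual_zero, LinearMap.zero_apply]
  surj := CharacterModule.dual_surjective_of_injective f h.inj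

/-- A character of `C ⊗ A` is a map from `C` to the character module of `A`; the hypothesis lifts it
to the character module of `B`, so every character of `C ⊗ A` extends to `C ⊗ B`. -/
theorem lTensor_injective (hD : ExtZero R C (CharacterModule D) 1) :
    Function.Injective (f.lTensor C) := by
  rw [← CharacterModule.dual_surjective_iff_injective]
  intro φ
  obtain ⟨φ, rfl⟩ := CharacterModule.homEquiv.surjective φ
  obtain ⟨ψ, rfl⟩ := h.dual.exists_lift hD φ
  refine ⟨CharacterModule.homEquiv ψ, DFunLike.ext _ _ fun z => ?_⟩
  induction z with
  | zero => exact (map_zero _).trans (map_zero _).symm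
  | add x y hx hy =>
    exact (map_add _ x y).trans (by rw [hx, hy]; exact (map_add _ x y).symm)
  | tmul c a => rfl

theorem lTensor (hD : ExtZero R C (CharacterModule D) 1) :
    IsSES (f.lTensor C) (g.lTensor C) :=
  ⟨h.lTensor_injective hD, lTensor_exact C h.exact h.surj, LinearMap.lTensor_surjective C h.surj⟩

theorem hom (hs : ∀ φ : C →ₗ[R] D, ∃ ψ : C →ₗ[R] B, g ∘ₗ ψ = φ) :
    IsSES (LinearMap.compRight R (M := C) f) (LinearMap.compRight R (M := C) g) where
  inj φ ψ hφψ := LinearMap.ext fun x => h.inj (LinearMap.congr_fun hφψ x)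
  exact φ := by
    constructor
    · intro hφ
      exact exists_comp_eq_of_injective h.exact h.inj φ hφ
    · rintro ⟨ψ, rfl⟩
      ext x
      exact h.exact.apply_apply_eq_zero _
  surj := hs

theorem torVanish_left (hB : TorVanish C B) (hD : TorVanish C D) : TorVanish C A := fun n =>
  h.dual.ext_right (hB n) (hD (n + 1))

theorem extVanish_right (hA : ExtVanish C A) (hB : ExtVanish C B) : ExtVanish C D := fun n =>
  h.ext_right (hB n) (hA (n + 1))

theorem extVanish_left (hs : ∀ φ : C →ₗ[R] D, ∃ ψ : C →ₗ[R] B, g ∘ₗ ψ = φ)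
    (hB : ExtVanish C B) (hD : ExtVanish C D) : ExtVanish C A
  | 0 => h.ext_left_one hs (hB 0)
  | n + 1 => h.ext_left (hD n) (hB (n + 1))

end IsSES

theorem unit_naturality (f : A →ₗ[R] B) (x : A) : unit C B (f x) = f.lTensor C ∘ₗ unit C A x := by
  ext c; simp

theorem counit_naturality (f : A →ₗ[R] B) (z : C ⊗[R] (C →ₗ[R] A)) :
    counit C B ((LinearMap.compRight R f).lTensor C z) = f (counit C A z) := by
  induction z with
  | zero => simp
  | add x y hx hy => simp only [map_add, hx, hy]
  | tmul c φ => rfl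

end Exact

end RelHom

/-! ### Finiteness of classical dimensions, with induction principles -/

namespace RelHom

variable {R : Type u} [CommRing R]

section Dimension

variable (R) in
/-- The injective dimension of `M` is finite. -/
def InjDimFinite (M : Type u) [AddCommGroup M] [Module R M] : Prop :=
  ∃ n, HasInjectiveDimensionLT (ModuleCat.of R M) n

variable (R) in
/-- The projective dimension of `M` is finite. -/
def ProjDimFinite (M : Type u) [AddCommGroup M] [Module R M] : Prop :=
  ∃ n, HasProjectiveDimensionLT (ModuleCat.of R M) n

theorem injDimFinite_iff {M : ModuleCat.{u} R} :
    InjDimFinite R M ↔ injectiveDimension M < ⊤ := by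
  rw [lt_top_iff_ne_top, injectiveDimension_ne_top_iff]
  exact ⟨fun ⟨n, h⟩ => ⟨n, @instHasInjectiveDimensionLTSucc _ _ _ _ _ h⟩, fun ⟨n, h⟩ => ⟨n + 1, h⟩⟩

theorem projDimFinite_iff {M : ModuleCat.{u} R} :
    ProjDimFinite R M ↔ projectiveDimension M < ⊤ := by
  rw [lt_top_iff_ne_top, projectiveDimension_ne_top_iff]
  exact ⟨fun ⟨n, h⟩ => ⟨n, @instHasProjectiveDimensionLTSucc _ _ _ _ _ h⟩,
    fun ⟨n, h⟩ => ⟨n + 1, h⟩⟩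

variable {A B D : Type u} [AddCommGroup A] [Module R A] [AddCommGroup B] [Module R B]
  [AddCommGroup D] [Module R D]

theorem InjDimFinite.of_injective [Module.Injective R A] : InjDimFinite R A :=
  have := Module.injective_object_of_injective_module R A
  ⟨1, inferInstance⟩

theorem ProjDimFinite.of_projective [Module.Projective R A] : ProjDimFinite R A :=
  ⟨1, inferInstance⟩

theorem InjDimFinite.of_subsingleton [Subsingleton A] : InjDimFinite R A :=
  ⟨0, (ModuleCat.isZero_of_subsingleton (ModuleCat.of R A)).hasInjectiveDimensionLT_zero⟩

theorem ProjDimFinite.of_subsingleton [Subsingleton A] : ProjDimFinite R A :=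
  ProjDimFinite.of_projective

theorem InjDimFinite.of_retract (h : InjDimFinite R B) (i : A →ₗ[R] B) (p : B →ₗ[R] A)
    (hpi : p ∘ₗ i = LinearMap.id) : InjDimFinite R A := by
  obtain ⟨n, hn⟩ := h
  exact ⟨n, Retract.hasInjectiveDimensionLT (X := ModuleCat.of R A) (Y := ModuleCat.of R B)
    ⟨ModuleCat.ofHom i, ModuleCat.ofHom p, by rw [← ModuleCat.ofHom_comp, hpi]; rfl⟩ n⟩

theorem ProjDimFinite.of_retract (h : ProjDimFinite R B) (i : A →ₗ[R] B) (p : B →ₗ[R] A)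
    (hpi : p ∘ₗ i = LinearMap.id) : ProjDimFinite R A := by
  obtain ⟨n, hn⟩ := h
  exact ⟨n, Retract.hasProjectiveDimensionLT (X := ModuleCat.of R A) (Y := ModuleCat.of R B)
    ⟨ModuleCat.ofHom i, ModuleCat.ofHom p, by rw [← ModuleCat.ofHom_comp, hpi]; rfl⟩ n⟩

theorem InjDimFinite.congr (h : InjDimFinite R A) (e : A ≃ₗ[R] B) : InjDimFinite R B :=
  h.of_retract e.symm.toLinearMap e.toLinearMap (by ext; simp)

theorem ProjDimFinite.congr (h : ProjDimFinite R A) (e : A ≃ₗ[R] B) : ProjDimFinite R B :=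
  h.of_retract e.symm.toLinearMap e.toLinearMap (by ext; simp)

namespace IsSES

variable {f : A →ₗ[R] B} {g : B →ₗ[R] D} (h : IsSES f g)
include h

theorem injDimFinite_left (hB : InjDimFinite R B) (hD : InjDimFinite R D) :
    InjDimFinite R A := by
  obtain ⟨n, hn⟩ := hB
  obtain ⟨m, hm⟩ := hD
  exact ⟨n + m + 1, h.shortExact.hasInjectiveDimensionLT_X₁ (n + m)
    (hasInjectiveDimensionLT_of_ge _ m _ (by omega))
    (hasInjectiveDimensionLT_of_ge _ n _ (by omega))⟩

theorem injDimFinite_right (hA : InjDimFinite R A) (hB : InjDimFinite R B) :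
    InjDimFinite R D := by
  obtain ⟨n, hn⟩ := hA
  obtain ⟨m, hm⟩ := hB
  exact ⟨n + m, h.shortExact.hasInjectiveDimensionLT_X₃ (n + m)
    (hasInjectiveDimensionLT_of_ge _ m _ (by omega))
    (hasInjectiveDimensionLT_of_ge _ n _ (by omega))⟩

theorem projDimFinite_left (hB : ProjDimFinite R B) (hD : ProjDimFinite R D) :
    ProjDimFinite R A := by
  obtain ⟨n, hn⟩ := hB
  obtain ⟨m, hm⟩ := hD
  exact ⟨n + m, h.shortExact.hasProjectiveDimensionLT_X₁ (n + m)
    (hasProjectiveDimensionLT_of_ge _ n _ (by omega))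
    (hasProjectiveDimensionLT_of_ge _ m _ (by omega))⟩

theorem projDimFinite_right (hA : ProjDimFinite R A) (hB : ProjDimFinite R B) :
    ProjDimFinite R D := by
  obtain ⟨n, hn⟩ := hA
  obtain ⟨m, hm⟩ := hB
  exact ⟨n + m + 1, h.shortExact.hasProjectiveDimensionLT_X₃ (n + m)
    (hasProjectiveDimensionLT_of_ge _ n _ (by omega))
    (hasProjectiveDimensionLT_of_ge _ m _ (by omega))⟩

end IsSES

theorem exists_isSES_injective (M : ModuleCat.{u} R) :
    ∃ (I K : ModuleCat.{u} R) (f : M →ₗ[R] I) (g : I →ₗ[R] K),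
      Module.Injective R I ∧ IsSES f g := by
  obtain ⟨⟨I, hI, f, hf⟩⟩ := EnoughInjectives.presentation M
  exact ⟨I, ModuleCat.of R (I ⧸ LinearMap.range f.hom), f.hom, _,
    Module.injective_module_of_injective_object R I,
    isSES_range f.hom ((ModuleCat.mono_iff_injective f).1 hf)⟩

theorem exists_isSES_projective (M : ModuleCat.{u} R) :
    ∃ (K P : ModuleCat.{u} R) (f : K →ₗ[R] P) (g : P →ₗ[R] M),
      Module.Projective R P ∧ IsSES f g := by
  obtain ⟨p⟩ := EnoughProjectives.presentation M
  exact ⟨ModuleCat.of R (LinearMap.ker p.f.hom), p.p, _, p.f.hom,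
    (IsProjective.iff_projective p.p).2 p.projective,
    isSES_ker p.f.hom ((ModuleCat.epi_iff_surjective p.f).1 p.epi)⟩

theorem InjDimFinite.induction {Q : ModuleCat.{u} R → Prop}
    (base : ∀ I : ModuleCat.{u} R, Module.Injective R I → Q I)
    (step : ∀ (M I K : ModuleCat.{u} R) (f : M →ₗ[R] I) (g : I →ₗ[R] K), Module.Injective R I →
      IsSES f g → Q K → Q M) {M : ModuleCat.{u} R} (h : InjDimFinite R M) : Q M := by
  obtain ⟨n, h⟩ := h
  -- Raising the bound by one makes the base case the injective modules instead of the zero modules.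
  replace h : HasInjectiveDimensionLT M (n + 1) := hasInjectiveDimensionLT_of_ge M n _ (by omega)
  induction n generalizing M with
  | zero =>
    have : Injective M := injective_iff_hasInjectiveDimensionLT_one.2 h
    exact base M (Module.injective_module_of_injective_object R M)
  | succ n ih =>
    obtain ⟨I, K, f, g, hI, hs⟩ := exists_isSES_injective M
    exact step M I K f g hI hs (ih ((hs.shortExact.hasInjectiveDimensionLT_X₃_iff n
      (Module.injective_object_of_injective_module R I)).2 h))

theorem ProjDimFinite.induction {Q : ModuleCat.{u} R → Prop}
    (base : ∀ P : ModuleCat.{u} R, Module.Projective R P → Q P)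
    (step : ∀ (M K P : ModuleCat.{u} R) (f : K →ₗ[R] P) (g : P →ₗ[R] M), Module.Projective R P →
      IsSES f g → Q K → Q M) {M : ModuleCat.{u} R} (h : ProjDimFinite R M) : Q M := by
  obtain ⟨n, h⟩ := h
  replace h : HasProjectiveDimensionLT M (n + 1) := hasProjectiveDimensionLT_of_ge M n _ (by omega)
  induction n generalizing M with
  | zero =>
    have : Projective M := projective_iff_hasProjectiveDimensionLT_one.2 h
    exact base M ((IsProjective.iff_projective M).2 this)
  | succ n ih =>
    obtain ⟨K, P, f, g, hP, hs⟩ := exists_isSES_projective M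
    exact step M K P f g hP hs (ih ((hs.shortExact.hasProjectiveDimensionLT_X₃_iff n
      ((IsProjective.iff_projective P).1 hP)).1 h))

variable {𝒳 : ObjectProperty (ModuleCat.{u} R)}

theorem FinRes.induction {Q : ModuleCat.{u} R → Prop}
    (base : ∀ M : ModuleCat.{u} R, Subsingleton M → Q M)
    (step : ∀ (M K X : ModuleCat.{u} R) (f : K →ₗ[R] X) (g : X →ₗ[R] M), 𝒳 X →
      IsSES f g → Q K → Q M) {n : ℕ} {M : ModuleCat.{u} R} (h : FinRes 𝒳 n M) : Q M := by
  induction n generalizing M with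
  | zero => exact base M h
  | succ n ih =>
    obtain ⟨K, X, f, g, hX, hK, hs⟩ := h
    exact step M K X f g hX hs (ih hK)

theorem FinCores.induction {Q : ModuleCat.{u} R → Prop}
    (base : ∀ M : ModuleCat.{u} R, Subsingleton M → Q M)
    (step : ∀ (M X K : ModuleCat.{u} R) (f : M →ₗ[R] X) (g : X →ₗ[R] K), 𝒳 X →
      IsSES f g → Q K → Q M) {n : ℕ} {M : ModuleCat.{u} R} (h : FinCores 𝒳 n M) : Q M := by
  induction n generalizing M with
  | zero => exact base M h
  | succ n ih =>
    obtain ⟨X, K, f, g, hX, hK, hs⟩ := h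
    exact step M X K f g hX hs (ih hK)

end Dimension

/-! ### Foxby equivalence -/

section Foxby

variable {C : ModuleCat.{u} R}

theorem subsingleton_tensor (C Z : Type*) [AddCommGroup C] [Module R C] [AddCommGroup Z]
    [Module R Z] [Subsingleton Z] : Subsingleton (C ⊗[R] Z) := by
  refine subsingleton_of_forall_eq 0 fun x => ?_
  induction x with
  | zero => rfl
  | add x y hx hy => rw [hx, hy, add_zero]
  | tmul c z => rw [Subsingleton.elim z 0, TensorProduct.tmul_zero]

theorem isCProjective_of_subsingleton (Z : ModuleCat.{u} R) (h : Subsingleton Z) :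
    IsCProjective C Z := by
  refine ⟨Z, inferInstance, ⟨⟨0, 0, fun _ => Subsingleton.elim _ _,
    fun _ => (subsingleton_tensor C Z).elim _ _⟩⟩⟩

theorem isCInjective_of_subsingleton (Z : ModuleCat.{u} R) (h : Subsingleton Z) :
    IsCInjective C Z :=
  ⟨Z, ⟨fun _ _ _ _ _ _ _ _ _ => ⟨0, fun _ => Subsingleton.elim _ _⟩⟩,
    ⟨⟨0, 0, fun _ => Subsingleton.elim _ _, fun _ => Subsingleton.elim _ _⟩⟩⟩

theorem isCProjective_tensor (P : Type u) [AddCommGroup P] [Module R P] [Module.Projective R P] :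
    IsCProjective C (ModuleCat.of R (C ⊗[R] P)) :=
  ⟨ModuleCat.of R P, inferInstanceAs (Module.Projective R P), ⟨LinearEquiv.refl R _⟩⟩

theorem isCInjective_hom (I : Type u) [AddCommGroup I] [Module R I] [h : Module.Injective R I] :
    IsCInjective C (ModuleCat.of R (C →ₗ[R] I)) :=
  ⟨ModuleCat.of R I, h, ⟨LinearEquiv.refl R _⟩⟩

variable (hC : IsSemidualizing C)
include hC

theorem IsCProjective.extVanish {T : ModuleCat.{u} R} (hT : IsCProjective C T) :
    ExtVanish C T := by
  obtain ⟨P, hP, ⟨e⟩⟩ := hT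
  exact (extVanish_tensor hC P).congr e.symm

theorem IsCInjective.torVanish {T : ModuleCat.{u} R} (hT : IsCInjective C T) :
    TorVanish C T := by
  obtain ⟨I, hI, ⟨e⟩⟩ := hT
  exact (torVanish_hom hC I).congr e.symm

theorem IsCProjective.exists_hom_equiv {T : ModuleCat.{u} R} (hT : IsCProjective C T) :
    ∃ P : ModuleCat.{u} R, Module.Projective R P ∧ Nonempty (P ≃ₗ[R] (C →ₗ[R] T)) := by
  obtain ⟨P, hP, ⟨e⟩⟩ := hT
  exact ⟨P, hP, ⟨(LinearEquiv.ofBijective _ (unit_bijective_of_projective hC P)).trans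
    (e.symm.congrRight)⟩⟩

theorem IsCInjective.exists_tensor_equiv {T : ModuleCat.{u} R} (hT : IsCInjective C T) :
    ∃ I : ModuleCat.{u} R, Module.Injective R I ∧ Nonempty (I ≃ₗ[R] C ⊗[R] T) := by
  obtain ⟨I, hI, ⟨e⟩⟩ := hT
  exact ⟨I, hI, ⟨(LinearEquiv.ofBijective _ (counit_bijective_of_injective hC I)).symm.trans
    (e.symm.lTensor C)⟩⟩

/-- Vanishing of `Ext(C, -)` on the syzygies, carried along the induction, keeps the sequences exact
under `Hom(C, -)`, which sends `C ⊗ P` back to `P`. -/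
theorem FinRes.extVanish_and_projDimFinite_hom {n : ℕ} {X : ModuleCat.{u} R}
    (h : FinRes (IsCProjective C) n X) : ExtVanish C X ∧ ProjDimFinite R (C →ₗ[R] X) := by
  refine h.induction (Q := fun X => ExtVanish C X ∧ ProjDimFinite R (C →ₗ[R] X)) ?_ ?_
  · intro M hM
    exact ⟨ExtVanish.of_subsingleton, ProjDimFinite.of_subsingleton⟩
  · rintro M K X f g hX hs ⟨hK1, hK2⟩
    obtain ⟨P, hP, ⟨e⟩⟩ := hX.exists_hom_equiv hC
    exact ⟨hs.extVanish_right hK1 (hX.extVanish hC),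
      (hs.hom (hs.exists_lift (hK1 0))).projDimFinite_right hK2
        (ProjDimFinite.of_projective.congr e)⟩

theorem FinCores.torVanish_and_injDimFinite_tensor {n : ℕ} {X : ModuleCat.{u} R}
    (h : FinCores (IsCInjective C) n X) : TorVanish C X ∧ InjDimFinite R (C ⊗[R] X) := by
  refine h.induction (Q := fun X => TorVanish C X ∧ InjDimFinite R (C ⊗[R] X)) ?_ ?_
  · intro M hM
    have : Subsingleton (C ⊗[R] M) := subsingleton_tensor _ _
    exact ⟨TorVanish.of_subsingleton, InjDimFinite.of_subsingleton⟩
  · rintro M X K f g hX hs ⟨hK1, hK2⟩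
    obtain ⟨I, hI, ⟨e⟩⟩ := hX.exists_tensor_equiv hC
    exact ⟨hs.torVanish_left (hX.torVanish hC) hK1,
      (hs.lTensor (hK1 0)).injDimFinite_left (InjDimFinite.of_injective.congr e) hK2⟩

omit hC in
-- Tor-vanishing passes to syzygies, so a finite projective resolution of `H` stays exact under `C ⊗
-- -`.
theorem exists_finRes_tensor {H : ModuleCat.{u} R} (h : ProjDimFinite R H)
    (hH : TorVanish C H) : ∃ n, FinRes (IsCProjective C) n (ModuleCat.of R (C ⊗[R] H)) := by
  revert hH
  refine h.induction (Q := fun H => TorVanish C H →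
    ∃ n, FinRes (IsCProjective C) n (ModuleCat.of R (C ⊗[R] H))) ?_ ?_
  · intro P hP _
    refine ⟨1, ModuleCat.of R PUnit, _, 0, LinearMap.id, isCProjective_tensor P,
      inferInstanceAs (Subsingleton PUnit), Function.injective_of_subsingleton _, ?_,
      Function.surjective_id⟩
    rw [LinearMap.exact_iff]
    simp
  · intro M K P f g hP hs ih hM
    obtain ⟨n, hn⟩ := ih (hs.torVanish_left TorVanish.of_projective hM)
    exact ⟨n + 1, _, _, _, _, isCProjective_tensor P, hn, hs.lTensor (hM 0)⟩

omit hC in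
theorem exists_finCores_hom {H : ModuleCat.{u} R} (h : InjDimFinite R H)
    (hH : ExtVanish C H) : ∃ n, FinCores (IsCInjective C) n (ModuleCat.of R (C →ₗ[R] H)) := by
  revert hH
  refine h.induction (Q := fun H => ExtVanish C H →
    ∃ n, FinCores (IsCInjective C) n (ModuleCat.of R (C →ₗ[R] H))) ?_ ?_
  · intro I hI _
    refine ⟨1, _, ModuleCat.of R PUnit, LinearMap.id, 0, isCInjective_hom I,
      inferInstanceAs (Subsingleton PUnit), Function.injective_id, ?_,
      Function.surjective_to_subsingleton _⟩
    rw [LinearMap.exact_iff]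
    simp
  · intro M I K f g hI hs ih hM
    obtain ⟨n, hn⟩ := ih (hs.extVanish_right hM ExtVanish.of_injective)
    exact ⟨n + 1, _, _, _, _, isCInjective_hom I, hn, hs.hom (hs.exists_lift (hM 0))⟩

/-- Modules of finite injective dimension lie in the Bass class, and their image under
`Hom(C, -)` has finite projective dimension as soon as this holds for injective modules. -/
theorem InjDimFinite.bass
    (hI : ∀ I : ModuleCat.{u} R, Module.Injective R I → ProjDimFinite R (C →ₗ[R] I))
    {M : ModuleCat.{u} R} (h : InjDimFinite R M) :
    ExtVanish C M ∧ Function.Bijective (counit C M) ∧ TorVanish C (C →ₗ[R] M) ∧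
      ProjDimFinite R (C →ₗ[R] M) := by
  refine h.induction (Q := fun M => ExtVanish C M ∧ Function.Bijective (counit C M) ∧
    TorVanish C (C →ₗ[R] M) ∧ ProjDimFinite R (C →ₗ[R] M)) ?_ ?_
  · intro I hinj
    exact ⟨ExtVanish.of_injective, counit_bijective_of_injective hC I, torVanish_hom hC I,
      hI I hinj⟩
  · rintro M I K f g hinj hs ⟨h1, h2, h3, h4⟩
    have hcI := counit_bijective_of_injective hC I
    have hsurj : Function.Surjective (LinearMap.compRight R (M := C) g) := by
      -- `Ext¹(C, M) = 0` is not yet known. After tensoring with `C`, the counits of `I` and `K`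
      -- turn the map into `g`, which is surjective; faithfulness removes the tensor factor.
      refine surjective_of_lTensor_surjective hC _ fun z => ?_
      obtain ⟨i, hi⟩ := hs.surj (counit C K z)
      obtain ⟨w, rfl⟩ := hcI.2 i
      exact ⟨w, h2.1 (by rw [counit_naturality, hi])⟩
    have hh := hs.hom (C := C) hsurj
    have hT := hh.lTensor (h3 0)
    refine ⟨hs.extVanish_left hsurj ExtVanish.of_injective h1, ?_,
      hh.torVanish_left (torVanish_hom hC I) h3, hh.projDimFinite_left (hI I hinj) h4⟩
    exact LinearMap.bijective_of_bijective_of_injective_of_left_exact _ _ f g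
      (counit C M) (counit C I) (counit C K) (LinearMap.ext fun z => (counit_naturality f z).symm)
      (LinearMap.ext fun z => (counit_naturality g z).symm) hT.exact hs.exact hcI h2.1 hT.inj hs.inj

/-- Modules of finite projective dimension lie in the Auslander class, and their tensor product
with `C` has finite injective dimension as soon as this holds for projective modules. -/
theorem ProjDimFinite.auslander
    (hP : ∀ P : ModuleCat.{u} R, Module.Projective R P → InjDimFinite R (C ⊗[R] P))
    {M : ModuleCat.{u} R} (h : ProjDimFinite R M) :
    ExtVanish C (C ⊗[R] M) ∧ Function.Bijective (unit C M) ∧ InjDimFinite R (C ⊗[R] M) := by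
  refine h.induction (Q := fun M => ExtVanish C (C ⊗[R] M) ∧ Function.Bijective (unit C M) ∧
    InjDimFinite R (C ⊗[R] M)) ?_ ?_
  · intro P hproj
    exact ⟨extVanish_tensor hC P, unit_bijective_of_projective hC P, hP P hproj⟩
  · rintro M K P f g hproj hs ⟨h1, h2, h3⟩
    have huP := unit_bijective_of_projective hC P
    have hinj : Function.Injective (f.lTensor C) := by
      -- Tor-vanishing is not available for `M`. Under `Hom(C, -)`, the units of `K` and `P` turn
      -- the map into `f`, which is injective, and faithfulness of `Hom(C, -)` concludes.
      refine injective_of_hom_injective hC _ fun φ hφ => ?_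
      obtain ⟨k, rfl⟩ := h2.2 φ
      rw [← unit_naturality, map_eq_zero_iff _ huP.1, map_eq_zero_iff _ hs.inj] at hφ
      rw [hφ, map_zero]
    have hT : IsSES (f.lTensor C) (g.lTensor C) :=
      ⟨hinj, lTensor_exact C hs.exact hs.surj, LinearMap.lTensor_surjective C hs.surj⟩
    have hh := hT.hom (hT.exists_lift (h1 0))
    refine ⟨hT.extVanish_right h1 (extVanish_tensor hC P), ?_,
      hT.injDimFinite_right h3 (hP P hproj)⟩
    exact LinearMap.bijective_of_surjective_of_bijective_of_right_exact f g _ _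
      (unit C K) (unit C P) (unit C M) (LinearMap.ext fun z => (unit_naturality f z).symm)
      (LinearMap.ext fun z => (unit_naturality g z).symm) hs.exact hh.exact h2.2 huP hs.surj hh.surj

/-- The two equivalences, deduced from the finiteness of the injective dimension of
`C`-projective modules and of the projective dimension of `C`-injective modules. -/
theorem relDim_lt_top_iff
    (hP : ∀ P : ModuleCat.{u} R, Module.Projective R P → InjDimFinite R (C ⊗[R] P))
    (hI : ∀ I : ModuleCat.{u} R, Module.Injective R I → ProjDimFinite R (C →ₗ[R] I))
    (M : ModuleCat.{u} R) :
    (relProjDim (IsCProjective C) M < ⊤ ↔ injectiveDimension M < ⊤) ∧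
    (relInjDim (IsCInjective C) M < ⊤ ↔ projectiveDimension M < ⊤) := by
  rw [relProjDim_lt_top_iff isCProjective_of_subsingleton, ← injDimFinite_iff,
    relInjDim_lt_top_iff isCInjective_of_subsingleton, ← projDimFinite_iff]
  refine ⟨⟨?_, ?_⟩, ⟨?_, ?_⟩⟩
  · rintro ⟨n, h⟩
    refine h.induction (Q := fun M => InjDimFinite R M) (fun M _ => InjDimFinite.of_subsingleton) ?_
    rintro M K X f g ⟨P, hproj, ⟨e⟩⟩ hs hK
    exact hs.injDimFinite_right hK ((hP P hproj).congr e.symm)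
  · intro h
    obtain ⟨-, h2, h3, h4⟩ := h.bass hC hI
    obtain ⟨n, hn⟩ := exists_finRes_tensor (H := ModuleCat.of R (C →ₗ[R] M)) h4 h3
    exact ⟨n, hn.congr (LinearEquiv.ofBijective _ h2)⟩
  · rintro ⟨n, h⟩
    refine h.induction (Q := fun M => ProjDimFinite R M)
      (fun M _ => ProjDimFinite.of_subsingleton) ?_
    rintro M X K f g ⟨I, hinj, ⟨e⟩⟩ hs hK
    exact hs.projDimFinite_left ((hI I hinj).congr e.symm) hK
  · intro h
    obtain ⟨h1, h2, h3⟩ := h.auslander hC hP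
    obtain ⟨n, hn⟩ := exists_finCores_hom (H := ModuleCat.of R (C ⊗[R] M)) h3 h1
    exact ⟨n, hn.congr (LinearEquiv.ofBijective _ h2).symm⟩

end Foxby

end RelHom

/-! ### Diagram lemmas: horseshoes, pushouts, pullbacks -/

namespace RelHom

variable {R : Type u} [CommRing R]

section Diagrams

variable {A B D : Type u} [AddCommGroup A] [Module R A] [AddCommGroup B] [Module R B]
  [AddCommGroup D] [Module R D]

theorem isSES_of_subsingleton [Subsingleton A] [Subsingleton B] [Subsingleton D]
    (f : A →ₗ[R] B) (g : B →ₗ[R] D) : IsSES f g :=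
  ⟨Function.injective_of_subsingleton _,
    fun _ => ⟨fun _ => ⟨0, Subsingleton.elim _ _⟩, fun _ => Subsingleton.elim _ _⟩,
    Function.surjective_to_subsingleton _⟩

variable {f : A →ₗ[R] B} {g : B →ₗ[R] D} (h : IsSES f g)

namespace IsSES

include h

/-- Horseshoe for embeddings: `B` embeds in `T × T'` by `(β, γ ∘ g)`, and the cokernels form a short
exact sequence. No injectivity of `T` is needed, since the extension `β` of `α` is given. -/
theorem exists_horseshoe_right {T K T' K' : Type u} [AddCommGroup T] [Module R T]
    [AddCommGroup K] [Module R K] [AddCommGroup T'] [Module R T'] [AddCommGroup K'] [Module R K']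
    {α : A →ₗ[R] T} {p : T →ₗ[R] K} {γ : D →ₗ[R] T'} {p' : T' →ₗ[R] K'}
    (hA : IsSES α p) (hD : IsSES γ p') (β : B →ₗ[R] T) (hβ : β ∘ₗ f = α) :
    ∃ (Q : ModuleCat.{u} R) (m : B →ₗ[R] T × T') (q : T × T' →ₗ[R] Q) (κ : K →ₗ[R] Q)
      (ρ : Q →ₗ[R] K'), IsSES m q ∧ IsSES κ ρ := by
  have hβ' : ∀ a, β (f a) = α a := fun a => LinearMap.congr_fun hβ a
  let m : B →ₗ[R] T × T' := β.prod (γ ∘ₗ g)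
  have hm : Function.Injective m := by
    rw [injective_iff_map_eq_zero]
    intro b hb
    obtain ⟨h1, h2⟩ := Prod.ext_iff.1 hb
    obtain ⟨a, rfl⟩ := (h.exact b).1 ((map_eq_zero_iff γ hD.inj).1 h2)
    have h3 : α a = 0 := (hβ' a).symm.trans h1
    rw [(map_eq_zero_iff α hA.inj).1 h3, map_zero]
  let q := (LinearMap.range m).mkQ
  have hmq : IsSES m q := isSES_range m hm
  obtain ⟨κ, hκ⟩ := exists_comp_eq_of_surjective hA.exact hA.surj
    (q ∘ₗ LinearMap.inl R T T') (by
      ext a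
      refine (hmq.exact _).2 ⟨f a, Prod.ext (hβ' a) ?_⟩
      simp [m, h.exact.apply_apply_eq_zero])
  obtain ⟨ρ, hρ⟩ := exists_comp_eq_of_surjective hmq.exact hmq.surj
    (p' ∘ₗ LinearMap.snd R T T') (by
      ext b
      simp [m, hD.exact.apply_apply_eq_zero])
  have hκ' : ∀ t, κ (p t) = q (t, 0) := fun t => LinearMap.congr_fun hκ t
  have hρ' : ∀ z, ρ (q z) = p' z.2 := fun z => LinearMap.congr_fun hρ z
  refine ⟨ModuleCat.of R ((T × T') ⧸ LinearMap.range m), m, q, κ, ρ, hmq, ?_, ?_, ?_⟩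
  · rw [injective_iff_map_eq_zero]
    intro k hk
    obtain ⟨t, rfl⟩ := hA.surj k
    rw [hκ'] at hk
    obtain ⟨b, hb⟩ := (hmq.exact _).1 hk
    obtain ⟨h1, h2⟩ := Prod.ext_iff.1 hb
    obtain ⟨a, rfl⟩ := (h.exact b).1 ((map_eq_zero_iff γ hD.inj).1 h2)
    exact (hA.exact t).2 ⟨a, (hβ' a).symm.trans h1⟩
  · intro z
    constructor
    · intro hz
      obtain ⟨⟨t, t'⟩, rfl⟩ := hmq.surj z
      rw [hρ'] at hz
      obtain ⟨d, rfl⟩ := (hD.exact t').1 hz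
      obtain ⟨b, rfl⟩ := h.surj d
      -- Modulo the image of `b`, the pair `(t, γ (g b))` equals `(t - β b, 0)`.
      refine ⟨p (t - β b), ?_⟩
      rw [hκ', ← sub_eq_zero, ← map_sub]
      exact (hmq.exact _).2 ⟨-b, by ext <;> simp [m]⟩
    · rintro ⟨k, rfl⟩
      obtain ⟨t, rfl⟩ := hA.surj k
      rw [hκ', hρ', map_zero]
  · intro k'
    obtain ⟨t', rfl⟩ := hD.surj k'
    exact ⟨q (0, t'), hρ' _⟩

theorem exists_horseshoe_left {T K T' K' : Type u} [AddCommGroup T] [Module R T]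
    [AddCommGroup K] [Module R K] [AddCommGroup T'] [Module R T'] [AddCommGroup K'] [Module R K']
    {α : K →ₗ[R] T} {p : T →ₗ[R] A} {γ : K' →ₗ[R] T'} {p' : T' →ₗ[R] D}
    (hA : IsSES α p) (hD : IsSES γ p') (β : T' →ₗ[R] B) (hβ : g ∘ₗ β = p') :
    ∃ (Q : ModuleCat.{u} R) (q : Q →ₗ[R] T × T') (m : T × T' →ₗ[R] B) (κ : K →ₗ[R] Q)
      (ρ : Q →ₗ[R] K'), IsSES q m ∧ IsSES κ ρ := by
  have hβ' : ∀ a, g (β a) = p' a := fun a => LinearMap.congr_fun hβ a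
  let m : T × T' →ₗ[R] B := (f ∘ₗ p).coprod β
  have hmap : ∀ t t', m (t, t') = f (p t) + β t' := fun t t' => by simp [m]
  have hgm : ∀ z, g (m z) = p' z.2 := fun z => by
    rw [hmap, map_add, h.exact.apply_apply_eq_zero, zero_add, hβ']
  have hm : Function.Surjective m := by
    intro b
    obtain ⟨t', ht'⟩ := hD.surj (g b)
    obtain ⟨a, ha⟩ := (h.exact (b - β t')).1 (by rw [map_sub, hβ', ht', sub_self])
    obtain ⟨t, rfl⟩ := hA.surj a
    exact ⟨(t, t'), by rw [hmap, ha, sub_add_cancel]⟩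
  have hmq : IsSES (LinearMap.ker m).subtype m := isSES_ker m hm
  obtain ⟨κ, hκ⟩ := exists_comp_eq_of_injective hmq.exact hmq.inj
    (LinearMap.inl R T T' ∘ₗ α) (by
      ext k
      simp [m, hA.exact.apply_apply_eq_zero])
  obtain ⟨ρ, hρ⟩ := exists_comp_eq_of_injective hD.exact hD.inj
    (LinearMap.snd R T T' ∘ₗ (LinearMap.ker m).subtype) (by
      ext ⟨z, hz⟩
      rw [LinearMap.mem_ker] at hz
      simpa [hz] using (hgm z).symm)
  have hκ' : ∀ k, (κ k : T × T') = (α k, 0) := fun k => LinearMap.congr_fun hκ k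
  have hρ' : ∀ z, γ (ρ z) = (z : T × T').2 := fun z => LinearMap.congr_fun hρ z
  refine ⟨ModuleCat.of R (LinearMap.ker m), (LinearMap.ker m).subtype, m, κ, ρ, hmq, ?_, ?_, ?_⟩
  · rw [injective_iff_map_eq_zero]
    intro k hk
    have h1 := hκ' k
    rw [hk] at h1
    exact (map_eq_zero_iff α hA.inj).1 (Prod.ext_iff.1 h1).1.symm
  · intro z
    constructor
    · intro hz
      obtain ⟨⟨t, t'⟩, hzm⟩ := z
      have h1 : t' = 0 := by rw [← show γ _ = t' from hρ' ⟨(t, t'), hzm⟩, hz, map_zero]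
      subst h1
      have h2 : f (p t) = 0 := by simpa [hmap] using hzm
      obtain ⟨k, rfl⟩ := (hA.exact t).1 ((map_eq_zero_iff f h.inj).1 h2)
      exact ⟨k, Subtype.ext (hκ' k)⟩
    · rintro ⟨k, rfl⟩
      apply hD.inj
      rw [hρ', hκ', map_zero]
  · intro k'
    obtain ⟨a, ha⟩ := (h.exact (β (γ k'))).1 (by rw [hβ', hD.exact.apply_apply_eq_zero])
    obtain ⟨t, rfl⟩ := hA.surj a
    refine ⟨⟨(-t, γ k'), ?_⟩, hD.inj (hρ' _)⟩
    rw [LinearMap.mem_ker, hmap, map_neg, map_neg, ha, neg_add_cancel]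

/-- `Y` is the pushout of `B ← A → X`; parallel arrows have the same cokernel. -/
theorem exists_pushout {X G : Type u} [AddCommGroup X] [Module R X] [AddCommGroup G] [Module R G]
    {x : A →ₗ[R] X} {y : X →ₗ[R] G} (h' : IsSES x y) :
    ∃ (Y : ModuleCat.{u} R) (a : B →ₗ[R] Y) (b : Y →ₗ[R] G) (c : X →ₗ[R] Y) (d : Y →ₗ[R] D),
      IsSES a b ∧ IsSES c d := by
  let m : A →ₗ[R] B × X := f.prod (-x)
  have hmap : ∀ a, m a = (f a, -x a) := fun _ => rfl
  have hm : Function.Injective m := fun a a' haa => h.inj (Prod.ext_iff.1 haa).1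
  let q := (LinearMap.range m).mkQ
  have hmq : IsSES m q := isSES_range m hm
  obtain ⟨b, hb⟩ := exists_comp_eq_of_surjective hmq.exact hmq.surj (y ∘ₗ LinearMap.snd R B X) (by
    ext a; simp [hmap, h'.exact.apply_apply_eq_zero])
  obtain ⟨d, hd⟩ := exists_comp_eq_of_surjective hmq.exact hmq.surj (g ∘ₗ LinearMap.fst R B X) (by
    ext a; simp [hmap, h.exact.apply_apply_eq_zero])
  have hb' : ∀ z, b (q z) = y z.2 := fun z => LinearMap.congr_fun hb z
  have hd' : ∀ z, d (q z) = g z.1 := fun z => LinearMap.congr_fun hd z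
  refine ⟨ModuleCat.of R ((B × X) ⧸ LinearMap.range m), q ∘ₗ LinearMap.inl R B X, b,
    q ∘ₗ LinearMap.inr R B X, d, ⟨?_, ?_, ?_⟩, ⟨?_, ?_, ?_⟩⟩
  · rw [injective_iff_map_eq_zero]
    intro z hz
    obtain ⟨a, ha⟩ := (hmq.exact _).1 hz
    obtain ⟨h1, h2⟩ := Prod.ext_iff.1 ha
    have h3 : x a = 0 := neg_eq_zero.1 h2
    rw [(map_eq_zero_iff x h'.inj).1 h3, map_zero] at h1
    exact h1.symm
  · intro w
    constructor
    · intro hw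
      obtain ⟨⟨z, t⟩, rfl⟩ := hmq.surj w
      rw [hb'] at hw
      obtain ⟨a, rfl⟩ := (h'.exact t).1 hw
      refine ⟨z + f a, ?_⟩
      rw [LinearMap.comp_apply, ← sub_eq_zero, ← map_sub]
      exact (hmq.exact _).2 ⟨a, by ext <;> simp [hmap]⟩
    · rintro ⟨z, rfl⟩
      rw [LinearMap.comp_apply, hb']
      simp
  · intro z
    obtain ⟨t, rfl⟩ := h'.surj z
    exact ⟨q (0, t), hb' _⟩
  · rw [injective_iff_map_eq_zero]
    intro z hz
    obtain ⟨a, ha⟩ := (hmq.exact _).1 hz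
    obtain ⟨h1, h2⟩ := Prod.ext_iff.1 ha
    have h3 : f a = 0 := h1
    rw [(map_eq_zero_iff f h.inj).1 h3, map_zero] at h2
    exact h2.symm
  · intro w
    constructor
    · intro hw
      obtain ⟨⟨z, t⟩, rfl⟩ := hmq.surj w
      rw [hd'] at hw
      obtain ⟨a, rfl⟩ := (h.exact z).1 hw
      refine ⟨t + x a, ?_⟩
      rw [LinearMap.comp_apply, ← sub_eq_zero, ← map_sub]
      exact (hmq.exact _).2 ⟨-a, by ext <;> simp [hmap]⟩
    · rintro ⟨z, rfl⟩
      rw [LinearMap.comp_apply, hd']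
      simp
  · intro z
    obtain ⟨t, rfl⟩ := h.surj z
    exact ⟨q (t, 0), hd' _⟩

theorem exists_pullback {X G : Type u} [AddCommGroup X] [Module R X] [AddCommGroup G] [Module R G]
    {x : G →ₗ[R] X} {y : X →ₗ[R] D} (h' : IsSES x y) :
    ∃ (Y : ModuleCat.{u} R) (a : G →ₗ[R] Y) (b : Y →ₗ[R] B) (c : A →ₗ[R] Y) (d : Y →ₗ[R] X),
      IsSES a b ∧ IsSES c d := by
  let m : B × X →ₗ[R] D := g.coprod (-y)
  have hmap : ∀ z t, m (z, t) = g z - y t := fun z t => by simp [m, sub_eq_add_neg]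
  have hmem : ∀ w : LinearMap.ker m, g (w : B × X).1 = y (w : B × X).2 := fun w => by
    rw [← sub_eq_zero, ← hmap]; exact w.2
  refine ⟨ModuleCat.of R (LinearMap.ker m),
    (LinearMap.inr R B X ∘ₗ x).codRestrict _ fun z => ?_,
    LinearMap.fst R B X ∘ₗ (LinearMap.ker m).subtype,
    (LinearMap.inl R B X ∘ₗ f).codRestrict _ fun z => ?_,
    LinearMap.snd R B X ∘ₗ (LinearMap.ker m).subtype, ⟨?_, ?_, ?_⟩, ⟨?_, ?_, ?_⟩⟩
  · simp [hmap, h'.exact.apply_apply_eq_zero]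
  · simp [hmap, h.exact.apply_apply_eq_zero]
  · intro z z' hz
    exact h'.inj (Prod.ext_iff.1 (Subtype.ext_iff.1 hz)).2
  · intro w
    constructor
    · intro hw
      have hw1 : (w : B × X).1 = 0 := hw
      have h1 := hmem w
      rw [hw1, map_zero] at h1
      obtain ⟨z, hz⟩ := (h'.exact _).1 h1.symm
      exact ⟨z, Subtype.ext (Prod.ext hw1.symm hz)⟩
    · rintro ⟨z, rfl⟩
      rfl
  · intro z
    obtain ⟨t, ht⟩ := h'.surj (g z)
    exact ⟨⟨(z, t), by rw [LinearMap.mem_ker, hmap, ht, sub_self]⟩, rfl⟩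
  · intro z z' hz
    exact h.inj (Prod.ext_iff.1 (Subtype.ext_iff.1 hz)).1
  · intro w
    constructor
    · intro hw
      have hw1 : (w : B × X).2 = 0 := hw
      have h1 := hmem w
      rw [hw1, map_zero] at h1
      obtain ⟨z, hz⟩ := (h.exact _).1 h1
      exact ⟨z, Subtype.ext (Prod.ext hz hw1.symm)⟩
    · rintro ⟨z, rfl⟩
      rfl
  · intro t
    obtain ⟨z, hz⟩ := h.surj (y t)
    exact ⟨⟨(z, t), by rw [LinearMap.mem_ker, hmap, hz, sub_self]⟩, rfl⟩

/-- Third isomorphism theorem for `A ⊆ B ⊆ T`, with `Z = T/A`. -/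
theorem exists_quotient {T G : Type u} [AddCommGroup T] [Module R T] [AddCommGroup G] [Module R G]
    {m : B →ₗ[R] T} {q : T →ₗ[R] G} (h' : IsSES m q) :
    ∃ (Z : ModuleCat.{u} R) (z : T →ₗ[R] Z) (a : D →ₗ[R] Z) (b : Z →ₗ[R] G),
      IsSES (m ∘ₗ f) z ∧ IsSES a b := by
  let z := (LinearMap.range (m ∘ₗ f)).mkQ
  have hz : IsSES (m ∘ₗ f) z := isSES_range _ (h'.inj.comp h.inj)
  obtain ⟨a, ha⟩ := exists_comp_eq_of_surjective h.exact h.surj (z ∘ₗ m) (by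
    rw [LinearMap.comp_assoc, hz.exact.linearMap_comp_eq_zero])
  obtain ⟨b, hb⟩ := exists_comp_eq_of_surjective hz.exact hz.surj q (by
    rw [← LinearMap.comp_assoc, h'.exact.linearMap_comp_eq_zero, LinearMap.zero_comp])
  have ha' : ∀ y, a (g y) = z (m y) := fun y => LinearMap.congr_fun ha y
  have hb' : ∀ t, b (z t) = q t := fun t => LinearMap.congr_fun hb t
  refine ⟨ModuleCat.of R (T ⧸ LinearMap.range (m ∘ₗ f)), z, a, b, hz, ?_, ?_, ?_⟩
  · rw [injective_iff_map_eq_zero]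
    intro d hd
    obtain ⟨y, rfl⟩ := h.surj d
    rw [ha'] at hd
    obtain ⟨t, ht⟩ := (hz.exact _).1 hd
    rw [← h'.inj ht, h.exact.apply_apply_eq_zero]
  · intro w
    constructor
    · intro hw
      obtain ⟨t, rfl⟩ := hz.surj w
      rw [hb'] at hw
      obtain ⟨y, rfl⟩ := (h'.exact _).1 hw
      exact ⟨g y, ha' y⟩
    · rintro ⟨d, rfl⟩
      obtain ⟨y, rfl⟩ := h.surj d
      rw [ha', hb', h'.exact.apply_apply_eq_zero]
  · intro w
    obtain ⟨t, rfl⟩ := h'.surj w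
    exact ⟨z t, hb' t⟩

/-- `Z` is the preimage of `A` under `m`. -/
theorem exists_kernel {T G : Type u} [AddCommGroup T] [Module R T] [AddCommGroup G] [Module R G]
    {q : G →ₗ[R] T} {m : T →ₗ[R] B} (h' : IsSES q m) :
    ∃ (Z : ModuleCat.{u} R) (z : Z →ₗ[R] T) (a : G →ₗ[R] Z) (b : Z →ₗ[R] A),
      IsSES z (g ∘ₗ m) ∧ IsSES a b := by
  have hz := isSES_ker (g ∘ₗ m) (h.surj.comp h'.surj)
  obtain ⟨a, ha⟩ := exists_comp_eq_of_injective hz.exact hz.inj q (by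
    rw [LinearMap.comp_assoc, h'.exact.linearMap_comp_eq_zero, LinearMap.comp_zero])
  obtain ⟨b, hb⟩ := exists_comp_eq_of_injective h.exact h.inj
    (m ∘ₗ (LinearMap.ker (g ∘ₗ m)).subtype) (by
      rw [← LinearMap.comp_assoc, hz.exact.linearMap_comp_eq_zero])
  have ha' : ∀ y, (a y : T) = q y := fun y => LinearMap.congr_fun ha y
  have hb' : ∀ t, f (b t) = m t := fun t => LinearMap.congr_fun hb t
  refine ⟨ModuleCat.of R (LinearMap.ker (g ∘ₗ m)), _, a, b, hz, ?_, ?_, ?_⟩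
  · intro y y' hy
    apply h'.inj
    rw [← ha', ← ha', hy]
  · intro w
    constructor
    · intro hw
      obtain ⟨y, hy⟩ := (h'.exact w).1 (by rw [← hb', hw, map_zero])
      exact ⟨y, Subtype.ext ((ha' y).trans hy)⟩
    · rintro ⟨y, rfl⟩
      apply h.inj
      rw [hb', ha', h'.exact.apply_apply_eq_zero, map_zero]
  · intro x
    obtain ⟨t, ht⟩ := h'.surj (f x)
    refine ⟨⟨t, ?_⟩, h.inj ?_⟩
    · rw [LinearMap.mem_ker, LinearMap.comp_apply, ht, h.exact.apply_apply_eq_zero]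
    · rw [hb', ht]

end IsSES

end Diagrams

end RelHom

/-! ### Complete resolutions and orthogonality -/

namespace RelHom

variable {R : Type u} [CommRing R] {𝒳 : ObjectProperty (ModuleCat.{u} R)}

/-- The augmented coresolution `0 → M → X 0 → X 1 → ⋯` stays exact under `Hom(-, T)`. -/
structure Coresolution.IsHomExact {M : ModuleCat.{u} R} (r : Coresolution 𝒳 M)
    (T : ModuleCat.{u} R) : Prop where
  exists_extend : ∀ φ : M →ₗ[R] T, ∃ ψ : r.X 0 →ₗ[R] T, ψ ∘ₗ r.ε = φ
  exact_zero : ∀ φ : r.X 0 →ₗ[R] T, φ ∘ₗ r.ε = 0 → ∃ ψ : r.X 1 →ₗ[R] T, ψ ∘ₗ r.d 0 = φ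
  exact : ∀ n, ∀ φ : r.X (n + 1) →ₗ[R] T, φ ∘ₗ r.d n = 0 →
    ∃ ψ : r.X (n + 2) →ₗ[R] T, ψ ∘ₗ r.d (n + 1) = φ

/-- The augmented resolution `⋯ → X 1 → X 0 → M → 0` stays exact under `Hom(T, -)`. -/
structure Resolution.IsHomExact {M : ModuleCat.{u} R} (r : Resolution 𝒳 M)
    (T : ModuleCat.{u} R) : Prop where
  exists_lift : ∀ φ : T →ₗ[R] M, ∃ ψ : T →ₗ[R] r.X 0, r.ε ∘ₗ ψ = φ
  exact_zero : ∀ φ : T →ₗ[R] r.X 0, r.ε ∘ₗ φ = 0 → ∃ ψ : T →ₗ[R] r.X 1, r.d 0 ∘ₗ ψ = φ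
  exact : ∀ n, ∀ φ : T →ₗ[R] r.X (n + 1), r.d n ∘ₗ φ = 0 →
    ∃ ψ : T →ₗ[R] r.X (n + 2), r.d (n + 1) ∘ₗ ψ = φ

theorem Coresolution.IsHomExact.tail {M T : ModuleCat.{u} R} {r : Coresolution 𝒳 M}
    (h : r.IsHomExact T) : r.tail.IsHomExact T where
  exists_extend φ := by
    obtain ⟨ψ, hψ⟩ := h.exact_zero (φ ∘ₗ r.toKer) (by
      rw [LinearMap.comp_assoc, r.toKer_exact.linearMap_comp_eq_zero, LinearMap.comp_zero])
    refine ⟨ψ, LinearMap.ext fun x => ?_⟩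
    obtain ⟨y, rfl⟩ := r.toKer_surjective x
    exact LinearMap.congr_fun hψ y
  exact_zero φ hφ := h.exact 0 φ (by
    ext x; exact LinearMap.congr_fun hφ (r.toKer x))
  exact n := h.exact (n + 1)

theorem Resolution.IsHomExact.tail {M T : ModuleCat.{u} R} {r : Resolution 𝒳 M}
    (h : r.IsHomExact T) : r.tail.IsHomExact T where
  exists_lift φ := by
    obtain ⟨ψ, hψ⟩ := h.exact_zero ((LinearMap.ker r.ε).subtype ∘ₗ φ) (by
      ext x; exact (φ x).2)
    exact ⟨ψ, LinearMap.ext fun x => Subtype.ext (LinearMap.congr_fun hψ x)⟩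
  exact_zero φ hφ := h.exact 0 φ (by
    ext x; exact congrArg Subtype.val (LinearMap.congr_fun hφ x))
  exact n := h.exact (n + 1)

/-- The complete resolution is cut at `G`. Its left half is a projective resolution, whose `Hom(-,
P_C)`-exactness is the vanishing of Ext; its right half is the coresolution. -/
theorem IsGCProjective.exists_resolution {C G : ModuleCat.{u} R} (h : IsGCProjective C G) :
    (∀ T, IsCProjective C T → ∀ n, ExtZero R G T (n + 1)) ∧
      ∃ s : Coresolution (IsCProjective C) G, ∀ T, IsCProjective C T → s.IsHomExact T := by
  obtain ⟨S, hS, ⟨e⟩⟩ := h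
  let π : S.A 0 →ₗ[R] G := e.symm.toLinearMap ∘ₗ (LinearMap.range (S.dA 0)).mkQ
  have hπ : Function.Surjective π := e.symm.surjective.comp (Submodule.mkQ_surjective _)
  have hπ' : Function.Exact (S.dA 0) π := fun x => by
    simp [π]
  let r : Resolution projectiveClass G :=
    ⟨S.A, hS.projective_A, S.dA, π, hS.exact.exact_A, hπ', hπ⟩
  obtain ⟨ι, hι⟩ := exists_comp_eq_of_surjective hπ' hπ S.mid
    hS.exact.exact_A_zero.linearMap_comp_eq_zero
  have hι' : ∀ x, ι (π x) = S.mid x := fun x => LinearMap.congr_fun hι x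
  let s : Coresolution (IsCProjective C) G :=
    { X := S.B
      mem := hS.cProjective_B
      d := S.dB
      ε := ι
      exact := hS.exact.exact_B
      exact_zero := fun x => by
        rw [hS.exact.exact_B_zero x, ← hι, LinearMap.coe_comp, hπ.range_comp]
      injective := by
        rw [injective_iff_map_eq_zero]
        intro x hx
        obtain ⟨a, rfl⟩ := hπ x
        rw [hι'] at hx
        exact (hπ' a).2 ((hS.exact.exact_A_zero a).1 hx) }
  refine ⟨fun T hT n => (r.extZero_iff T n).2 fun φ => ((hS.exact_hom T hT).exact_A n φ).1,
    s, fun T hT => ⟨fun φ => ?_, fun φ hφ => ?_, fun n φ => ((hS.exact_hom T hT).exact_B n φ).1⟩⟩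
  · obtain ⟨ψ, hψ⟩ := ((hS.exact_hom T hT).exact_A_zero (φ ∘ₗ π)).1
      (show (φ ∘ₗ π) ∘ₗ S.dA 0 = 0 by
        rw [LinearMap.comp_assoc, hπ'.linearMap_comp_eq_zero, LinearMap.comp_zero])
    refine ⟨ψ, LinearMap.ext fun x => ?_⟩
    obtain ⟨a, rfl⟩ := hπ x
    exact (congrArg ψ (hι' a)).trans (LinearMap.congr_fun hψ a)
  · refine ((hS.exact_hom T hT).exact_B_zero φ).1 (show φ ∘ₗ S.mid = 0 from ?_)
    rw [← hι, ← LinearMap.comp_assoc, show φ ∘ₗ ι = 0 from hφ, LinearMap.zero_comp]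

theorem IsGCInjective.exists_coresolution {C G : ModuleCat.{u} R} (h : IsGCInjective C G) :
    (∀ T, IsCInjective C T → ∀ n, ExtZero R T G (n + 1)) ∧
      ∃ s : Resolution (IsCInjective C) G, ∀ T, IsCInjective C T → s.IsHomExact T := by
  obtain ⟨S, hS, ⟨e⟩⟩ := h
  let ι : G →ₗ[R] S.B 0 := (LinearMap.ker (S.dB 0)).subtype ∘ₗ e.toLinearMap
  have hι : Function.Injective ι := Subtype.val_injective.comp e.injective
  have hι' : Function.Exact ι (S.dB 0) := fun x => by
    constructor
    · intro hx
      exact ⟨e.symm ⟨x, hx⟩, by simp [ι]⟩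
    · rintro ⟨y, rfl⟩
      exact (e y).2
  let r : Coresolution injectiveClass G :=
    ⟨S.B, hS.injective_B, S.dB, ι, hS.exact.exact_B, hι', hι⟩
  obtain ⟨π, hπ⟩ := exists_comp_eq_of_injective hι' hι S.mid
    hS.exact.exact_B_zero.linearMap_comp_eq_zero
  have hπ' : ∀ x, ι (π x) = S.mid x := fun x => LinearMap.congr_fun hπ x
  let s : Resolution (IsCInjective C) G :=
    { X := S.A
      mem := hS.cInjective_A
      d := S.dA
      ε := π
      exact := hS.exact.exact_A
      exact_zero := fun x => by
        rw [← hS.exact.exact_A_zero x, ← hπ', map_eq_zero_iff ι hι]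
      surjective := fun x => by
        obtain ⟨a, ha⟩ := (hS.exact.exact_B_zero (ι x)).1 (hι'.apply_apply_eq_zero x)
        exact ⟨a, hι ((hπ' a).trans ha)⟩ }
  refine ⟨fun T hT n => (r.extZero_iff T n).2 fun φ => ((hS.exact_hom T hT).exact_B n φ).1,
    s, fun T hT => ⟨fun φ => ?_, fun φ hφ => ?_, fun n φ => ((hS.exact_hom T hT).exact_A n φ).1⟩⟩
  · obtain ⟨ψ, hψ⟩ := ((hS.exact_hom T hT).exact_B_zero (ι ∘ₗ φ)).1
      (show S.dB 0 ∘ₗ ι ∘ₗ φ = 0 by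
        rw [← LinearMap.comp_assoc, hι'.linearMap_comp_eq_zero, LinearMap.zero_comp])
    exact ⟨ψ, LinearMap.ext fun x => hι ((hπ' _).trans (LinearMap.congr_fun hψ x))⟩
  · refine ((hS.exact_hom T hT).exact_A_zero φ).1 (show S.mid ∘ₗ φ = 0 from ?_)
    rw [← hπ, LinearMap.comp_assoc, show π ∘ₗ φ = 0 from hφ, LinearMap.comp_zero]

/-- By adjunction, lifting a map `C ⊗ P → K` to `I` means lifting `P → Hom(C, K)` to `Hom(C, I)`.
This is possible because `P` is projective and `Ext¹(C, N) = 0` makes `Hom(C, I) → Hom(C, K)`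
surjective. -/
theorem IsCProjective.extZero_one {C T : ModuleCat.{u} R} (hT : IsCProjective C T)
    {N : ModuleCat.{u} R} (hN : ExtZero R C N 1) : ExtZero R T N 1 := by
  obtain ⟨P, hP, ⟨e⟩⟩ := hT
  refine ExtZero.congr_left ?_ e.symm
  obtain ⟨I, K, f, g, hI, hs⟩ := exists_isSES_injective N
  refine hs.ext_left_one (fun φ => ?_) (ExtZero.of_injective 0)
  have hh := hs.hom (hs.exists_lift hN)
  obtain ⟨ψ, hψ⟩ := Module.projective_lifting_property _ (TensorProduct.curry φ).flip hh.surj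
  refine ⟨TensorProduct.lift ψ.flip, TensorProduct.ext' fun c p => ?_⟩
  exact LinearMap.congr_fun (LinearMap.congr_fun hψ p) c

theorem IsCInjective.extZero_one {C T : ModuleCat.{u} R} (hT : IsCInjective C T)
    {N : ModuleCat.{u} R} (hN : ExtZero R C (CharacterModule N) 1) : ExtZero R N T 1 := by
  obtain ⟨I, hI, ⟨e⟩⟩ := hT
  refine ExtZero.congr_right ?_ e.symm
  obtain ⟨K, P, f, g, hP, hs⟩ := exists_isSES_projective N
  refine hs.ext_right_one' (fun φ => ?_) (ExtZero.of_projective 0)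
  obtain ⟨ψ, hψ⟩ := Module.Injective.extension_property R I _ _ _ (hs.lTensor_injective hN)
    (TensorProduct.lift φ.flip)
  refine ⟨(TensorProduct.curry ψ).flip, LinearMap.ext fun k => LinearMap.ext fun c => ?_⟩
  exact LinearMap.congr_fun hψ (c ⊗ₜ k)

theorem IsCProjective.prod {C T T' : ModuleCat.{u} R} (hT : IsCProjective C T)
    (hT' : IsCProjective C T') : IsCProjective C (ModuleCat.of R (T × T')) := by
  obtain ⟨P, hP, ⟨e⟩⟩ := hT
  obtain ⟨P', hP', ⟨e'⟩⟩ := hT'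
  exact ⟨ModuleCat.of R (P × P'), inferInstanceAs (Module.Projective R (P × P')),
    ⟨(e.prodCongr e').trans (TensorProduct.prodRight R R C P P').symm⟩⟩

theorem IsCInjective.prod {C T T' : ModuleCat.{u} R} (hT : IsCInjective C T)
    (hT' : IsCInjective C T') : IsCInjective C (ModuleCat.of R (T × T')) := by
  obtain ⟨I, hI, ⟨e⟩⟩ := hT
  obtain ⟨I', hI', ⟨e'⟩⟩ := hT'
  refine ⟨ModuleCat.of R (I × I'), ⟨fun X Y _ _ _ _ f hf φ => ?_⟩,
    ⟨(e.prodCongr e').trans (LinearMap.prodEquiv R)⟩⟩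
  obtain ⟨a, ha⟩ := Module.Injective.extension_property R I _ _ f hf (LinearMap.fst R I I' ∘ₗ φ)
  obtain ⟨b, hb⟩ := Module.Injective.extension_property R I' _ _ f hf (LinearMap.snd R I I' ∘ₗ φ)
  exact ⟨a.prod b, fun x => Prod.ext (LinearMap.congr_fun ha x) (LinearMap.congr_fun hb x)⟩

/-- `Y` is left orthogonal to the `C`-projective modules and has `k` successive embeddings into
`C`-projective modules whose cokernels are left orthogonal to the `C`-projective modules. -/
def IsLeftOrthogonal (C : ModuleCat.{u} R) : ℕ → ModuleCat.{u} R → Prop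
  | 0, Y => ∀ T, IsCProjective C T → ExtZero R Y T 1
  | k + 1, Y => (∀ T, IsCProjective C T → ExtZero R Y T 1) ∧
      ∃ (T K : ModuleCat.{u} R) (f : Y →ₗ[R] T) (g : T →ₗ[R] K),
        IsCProjective C T ∧ IsLeftOrthogonal C k K ∧ IsSES f g

/-- `Y` is right orthogonal to the `C`-injective modules and has `k` successive coverings by
`C`-injective modules whose kernels are right orthogonal to the `C`-injective modules. -/
def IsRightOrthogonal (C : ModuleCat.{u} R) : ℕ → ModuleCat.{u} R → Prop
  | 0, Y => ∀ T, IsCInjective C T → ExtZero R T Y 1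
  | k + 1, Y => (∀ T, IsCInjective C T → ExtZero R T Y 1) ∧
      ∃ (K T : ModuleCat.{u} R) (f : K →ₗ[R] T) (g : T →ₗ[R] Y),
        IsCInjective C T ∧ IsRightOrthogonal C k K ∧ IsSES f g

variable {C : ModuleCat.{u} R}

theorem isLeftOrthogonal_of_subsingleton (k : ℕ) (Y : ModuleCat.{u} R) (hY : Subsingleton Y) :
    IsLeftOrthogonal C k Y := by
  induction k with
  | zero => exact fun T _ => ExtZero.of_projective 0
  | succ k ih =>
    exact ⟨fun T _ => ExtZero.of_projective 0, Y, Y, 0, 0, isCProjective_of_subsingleton Y hY, ih,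
      isSES_of_subsingleton _ _⟩

theorem isRightOrthogonal_of_subsingleton (k : ℕ) (Y : ModuleCat.{u} R) (hY : Subsingleton Y) :
    IsRightOrthogonal C k Y := by
  have : Module.Injective R Y := ⟨fun _ _ _ _ _ _ _ _ _ => ⟨0, fun _ => Subsingleton.elim _ _⟩⟩
  induction k with
  | zero => exact fun T _ => ExtZero.of_injective 0
  | succ k ih =>
    exact ⟨fun T _ => ExtZero.of_injective 0, Y, Y, 0, 0, isCInjective_of_subsingleton Y hY, ih,
      isSES_of_subsingleton _ _⟩

/-- Closure under extensions by repeated horseshoes; orthogonality of `D` supplies the extension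
`β`. The finite depth `k` avoids building a complete resolution of `B`. -/
theorem IsLeftOrthogonal.of_isSES {k : ℕ} {A B D : ModuleCat.{u} R} {f : A →ₗ[R] B}
    {g : B →ₗ[R] D} (hs : IsSES f g) (hA : IsLeftOrthogonal C k A)
    (hD : IsLeftOrthogonal C k D) : IsLeftOrthogonal C k B := by
  induction k generalizing A B D with
  | zero => exact fun T hT => hs.ext_mid' (hA T hT) (hD T hT)
  | succ k ih =>
    obtain ⟨hA1, T, K, α, p, hT, hK, hα⟩ := hA
    obtain ⟨hD1, T', K', γ, p', hT', hK', hγ⟩ := hD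
    obtain ⟨β, hβ⟩ := hs.exists_extend (hD1 T hT) α
    obtain ⟨Q, m, q, κ, ρ, h1, h2⟩ := hs.exists_horseshoe_right hα hγ β hβ
    exact ⟨fun T hT => hs.ext_mid' (hA1 T hT) (hD1 T hT), ModuleCat.of R (T × T'), Q, m, q,
      hT.prod hT', ih h2 hK hK', h1⟩

theorem IsRightOrthogonal.of_isSES {k : ℕ} {A B D : ModuleCat.{u} R} {f : A →ₗ[R] B}
    {g : B →ₗ[R] D} (hs : IsSES f g) (hA : IsRightOrthogonal C k A)
    (hD : IsRightOrthogonal C k D) : IsRightOrthogonal C k B := by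
  induction k generalizing A B D with
  | zero => exact fun T hT => hs.ext_mid (hA T hT) (hD T hT)
  | succ k ih =>
    obtain ⟨hA1, K, T, α, p, hT, hK, hα⟩ := hA
    obtain ⟨hD1, K', T', γ, p', hT', hK', hγ⟩ := hD
    obtain ⟨β, hβ⟩ := hs.exists_lift (hA1 T' hT') p'
    obtain ⟨Q, q, m, κ, ρ, h1, h2⟩ := hs.exists_horseshoe_left hα hγ β hβ
    exact ⟨fun T hT => hs.ext_mid (hA1 T hT) (hD1 T hT), Q, ModuleCat.of R (T × T'), q, m,
      hT.prod hT', ih h2 hK hK', h1⟩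

section Semidualizing

variable (hC : IsSemidualizing C)
include hC

/-- Each cosyzygy is again orthogonal: maps from `G` to `T` extend to `s.X 0`, and `Ext¹(s.X 0, T) =
0`. -/
theorem Coresolution.isLeftOrthogonal {G : ModuleCat.{u} R}
    (s : Coresolution (IsCProjective C) G) (hs : ∀ T, IsCProjective C T → s.IsHomExact T)
    (hG : ∀ T, IsCProjective C T → ExtZero R G T 1) (k : ℕ) : IsLeftOrthogonal C k G := by
  induction k generalizing G with
  | zero => exact hG
  | succ k ih =>
    exact ⟨hG, _, _, _, _, s.mem 0, ih s.tail (fun T hT => (hs T hT).tail)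
      fun T hT => s.isSES.ext_right_one' (hs T hT).exists_extend
        ((s.mem 0).extZero_one (hT.extVanish hC 0)), s.isSES⟩

theorem Resolution.isRightOrthogonal {G : ModuleCat.{u} R}
    (s : Resolution (IsCInjective C) G) (hs : ∀ T, IsCInjective C T → s.IsHomExact T)
    (hG : ∀ T, IsCInjective C T → ExtZero R T G 1) (k : ℕ) : IsRightOrthogonal C k G := by
  induction k generalizing G with
  | zero => exact hG
  | succ k ih =>
    exact ⟨hG, _, _, _, _, s.mem 0, ih s.tail (fun T hT => (hs T hT).tail)
      fun T hT => s.isSES.ext_left_one (hs T hT).exists_lift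
        ((s.mem 0).extZero_one (hT.torVanish hC 0)), s.isSES⟩

theorem IsGCProjective.isLeftOrthogonal {G : ModuleCat.{u} R} (h : IsGCProjective C G) (k : ℕ) :
    IsLeftOrthogonal C k G := by
  obtain ⟨hG, s, hs⟩ := h.exists_resolution
  exact s.isLeftOrthogonal hC hs (fun T hT => hG T hT 0) k

theorem IsGCInjective.isRightOrthogonal {G : ModuleCat.{u} R} (h : IsGCInjective C G) (k : ℕ) :
    IsRightOrthogonal C k G := by
  obtain ⟨hG, s, hs⟩ := h.exists_coresolution
  exact s.isRightOrthogonal hC hs (fun T hT => hG T hT 0) k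

/-! ### Auslander–Buchweitz approximations and the two finiteness facts -/

/-- The Auslander–Buchweitz approximation of a module of finite `G_C`-projective dimension by a
module of finite `P_C`-projective dimension. -/
theorem FinRes.exists_approximation {n : ℕ} {M : ModuleCat.{u} R}
    (h : FinRes (IsGCProjective C) n M) (k : ℕ) :
    ∃ (X G : ModuleCat.{u} R) (f : M →ₗ[R] X) (g : X →ₗ[R] G),
      (∃ m, FinRes (IsCProjective C) m X) ∧ IsLeftOrthogonal C k G ∧ IsSES f g := by
  refine h.induction (Q := fun M => ∀ k, ∃ (X G : ModuleCat.{u} R) (f : M →ₗ[R] X)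
    (g : X →ₗ[R] G), (∃ m, FinRes (IsCProjective C) m X) ∧ IsLeftOrthogonal C k G ∧
      IsSES f g) ?_ ?_ k
  · intro M hM k
    exact ⟨M, M, 0, 0, ⟨0, hM⟩, isLeftOrthogonal_of_subsingleton k M hM,
      isSES_of_subsingleton _ _⟩
  · intro M K G f g hG hs ih k
    -- One level of orthogonality is spent on embedding the pushout `Y`, an extension of `G'` by
    -- `G`, into a `C`-projective `T`. Then `Z = T/X` contains `Y/X = M` with quotient `T/Y = K'`,
    -- and `0 → X → T → Z → 0` lengthens the `P_C`-resolution by one.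
    obtain ⟨X, G', x, y, ⟨m, hX⟩, hG', hs'⟩ := ih (k + 1)
    obtain ⟨Y, a, b, c, d, hab, hcd⟩ := hs.exists_pushout hs'
    obtain ⟨-, T, K', t, q, hT, hK', htq⟩ :=
      IsLeftOrthogonal.of_isSES hab (hG.isLeftOrthogonal hC (k + 1)) hG'
    obtain ⟨Z, z, a', b', h1, h2⟩ := hcd.exists_quotient htq
    exact ⟨Z, K', a', b', ⟨m + 1, X, T, _, z, hT, hX, h1⟩, hK', h2⟩

/-- The Auslander–Buchweitz approximation of a module of finite `G_C`-injective dimension by a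
module of finite `I_C`-injective dimension. -/
theorem FinCores.exists_approximation {n : ℕ} {M : ModuleCat.{u} R}
    (h : FinCores (IsGCInjective C) n M) (k : ℕ) :
    ∃ (G X : ModuleCat.{u} R) (f : G →ₗ[R] X) (g : X →ₗ[R] M),
      (∃ m, FinCores (IsCInjective C) m X) ∧ IsRightOrthogonal C k G ∧ IsSES f g := by
  refine h.induction (Q := fun M => ∀ k, ∃ (G X : ModuleCat.{u} R) (f : G →ₗ[R] X)
    (g : X →ₗ[R] M), (∃ m, FinCores (IsCInjective C) m X) ∧ IsRightOrthogonal C k G ∧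
      IsSES f g) ?_ ?_ k
  · intro M hM k
    exact ⟨M, M, 0, 0, ⟨0, hM⟩, isRightOrthogonal_of_subsingleton k M hM,
      isSES_of_subsingleton _ _⟩
  · intro M G K f g hG hs ih k
    -- Dually, a `C`-injective `T` covers the pullback `Y`, and `Z` is the preimage in `T` of `M`,
    -- the kernel of `Y → X`.
    obtain ⟨G', X, x, y, ⟨m, hX⟩, hG', hs'⟩ := ih (k + 1)
    obtain ⟨Y, a, b, c, d, hab, hcd⟩ := hs.exists_pullback hs'
    obtain ⟨-, K', T, q, t, hT, hK', hqt⟩ :=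
      IsRightOrthogonal.of_isSES hab hG' (hG.isRightOrthogonal hC (k + 1))
    obtain ⟨Z, z, a', b', h1, h2⟩ := hcd.exists_kernel hqt
    exact ⟨K', Z, a', b', ⟨m + 1, T, X, z, _, hT, hX, h1⟩, hK', h2⟩

omit hC in
theorem FinRes.extZero {𝒳 : ObjectProperty (ModuleCat.{u} R)} {T : ModuleCat.{u} R}
    (hT : ∀ X, 𝒳 X → ∀ j, ExtZero R X T (j + 1)) {n : ℕ} {M : ModuleCat.{u} R}
    (h : FinRes 𝒳 n M) (j : ℕ) : ExtZero R M T (n + j + 1) := by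
  induction n generalizing M with
  | zero =>
    have : Subsingleton M := h
    exact ExtZero.of_projective _
  | succ n ih =>
    obtain ⟨K, X, f, g, hX, hK, hs⟩ := h
    have := hs.ext_right' (ih hK) (hT X hX _)
    rwa [show n + 1 + j + 1 = n + j + 1 + 1 by omega]

omit hC in
theorem FinCores.extZero {𝒳 : ObjectProperty (ModuleCat.{u} R)} {T : ModuleCat.{u} R}
    (hT : ∀ X, 𝒳 X → ∀ j, ExtZero R T X (j + 1)) {n : ℕ} {M : ModuleCat.{u} R}
    (h : FinCores 𝒳 n M) (j : ℕ) : ExtZero R T M (n + j + 1) := by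
  induction n generalizing M with
  | zero =>
    have : Subsingleton M := h
    have : Module.Injective R M := ⟨fun _ _ _ _ _ _ _ _ _ => ⟨0, fun _ => Subsingleton.elim _ _⟩⟩
    exact ExtZero.of_injective _
  | succ n ih =>
    obtain ⟨X, K, f, g, hX, hK, hs⟩ := h
    have := hs.ext_left (ih hK) (hT X hX _)
    rwa [show n + 1 + j + 1 = n + j + 1 + 1 by omega]

omit hC in
-- The bound `n` is the same for all `M`, so `Ext^i(-, T)` vanishes identically for `i ≥ n + 1`.
theorem injDimFinite_of_finRes {n : ℕ} (h : ∀ M, FinRes (IsGCProjective C) n M)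
    {T : ModuleCat.{u} R} (hT : IsCProjective C T) : InjDimFinite R T := by
  refine ⟨n + 1, (hasInjectiveDimensionLT_iff (ModuleCat.of R T) _).2 fun i hi M x => ?_⟩
  obtain ⟨j, rfl⟩ := Nat.exists_eq_add_of_le hi
  revert x
  rw [show n + 1 + j = n + j + 1 by omega]
  exact extZero_iff.1 ((h M).extZero (fun X hX => hX.exists_resolution.1 T hT) j)

omit hC in
theorem projDimFinite_of_finCores {n : ℕ} (h : ∀ M, FinCores (IsGCInjective C) n M)
    {T : ModuleCat.{u} R} (hT : IsCInjective C T) : ProjDimFinite R T := by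
  refine ⟨n + 1, (hasProjectiveDimensionLT_iff (ModuleCat.of R T) _).2 fun i hi M x => ?_⟩
  obtain ⟨j, rfl⟩ := Nat.exists_eq_add_of_le hi
  revert x
  rw [show n + 1 + j = n + j + 1 by omega]
  exact extZero_iff.1 ((h M).extZero (fun X hX => hX.exists_coresolution.1 T hT) j)

theorem projDimFinite_hom_of_finRes {n : ℕ} {I : ModuleCat.{u} R} (hI : Module.Injective R I)
    (h : FinRes (IsGCProjective C) n I) : ProjDimFinite R (C →ₗ[R] I) := by
  -- Depth `0` suffices: only the embedding `I → X` is used, and it splits since `I` is injective.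
  obtain ⟨X, G, f, g, ⟨m, hX⟩, -, hs⟩ := h.exists_approximation hC 0
  obtain ⟨p, hp⟩ := Module.Injective.extension_property R I _ _ f hs.inj LinearMap.id
  refine (hX.extVanish_and_projDimFinite_hom hC).2.of_retract (LinearMap.compRight R f)
    (LinearMap.compRight R p) (LinearMap.ext fun φ => LinearMap.ext fun c => ?_)
  exact LinearMap.congr_fun hp (φ c)

theorem injDimFinite_tensor_of_finCores {n : ℕ} {P : ModuleCat.{u} R}
    (hP : Module.Projective R P) (h : FinCores (IsGCInjective C) n P) :
    InjDimFinite R (C ⊗[R] P) := by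
  obtain ⟨G, X, f, g, ⟨m, hX⟩, -, hs⟩ := h.exists_approximation hC 0
  obtain ⟨i, hi⟩ := Module.projective_lifting_property g LinearMap.id hs.surj
  refine (hX.torVanish_and_injDimFinite_tensor hC).2.of_retract (i.lTensor C) (g.lTensor C) ?_
  rw [← LinearMap.lTensor_comp, hi, LinearMap.lTensor_id]

end Semidualizing

end RelHom

/-- The `C`-Gorenstein global dimension of `R` is the common value of `gcProjGlobalDim C` and
`gcInjGlobalDim C`. That these two agree is not assumed here: it is enough that one of them
is finite. -/
theorem proposition4p7 {R : Type u} [CommRing R] (C : ModuleCat.{u} R)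
    (hC : RelHom.IsSemidualizing C)
    (h : RelHom.gcProjGlobalDim C < ⊤ ∨ RelHom.gcInjGlobalDim C < ⊤)
    (M : ModuleCat.{u} R) :
    (RelHom.relProjDim (RelHom.IsCProjective C) M < ⊤ ↔ injectiveDimension M < ⊤) ∧
    (RelHom.relInjDim (RelHom.IsCInjective C) M < ⊤ ↔ projectiveDimension M < ⊤) := by
  rcases h with h | h
  · obtain ⟨n, hn⟩ := RelHom.exists_finRes_of_gcProjGlobalDim h
    exact RelHom.relDim_lt_top_iff hC
      (fun P _ => RelHom.injDimFinite_of_finRes hn (RelHom.isCProjective_tensor P))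
      (fun I hI => RelHom.projDimFinite_hom_of_finRes hC hI (hn I)) M
  · obtain ⟨n, hn⟩ := RelHom.exists_finCores_of_gcInjGlobalDim h
    exact RelHom.relDim_lt_top_iff hC
      (fun P hP => RelHom.injDimFinite_tensor_of_finCores hC hP (hn P))
      (fun I _ => RelHom.projDimFinite_of_finCores hn (RelHom.isCInjective_hom I)) M
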